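/- **Setting.** Let $\tau$ be a fixed number of classes, $\mathcal T=[\tau]$. The labels $T_1,\dots,T_\ell$ of $\ell$ objects are i.i.d. with an unknown law $P_T$ on $\mathcal T$; the correct clustering $P^*(T^\ell)$ puts two objects together if and only if their labels agree. Responses take values in $\mathcal Y=\mathcal T\cup\{\xi\}$, $\xi$ being a null response. A *worker* who is shown $\ell$ objects with labels $t_1,\dots,t_\ell$ (in this order) gives responses with law $\prod_{i=1}^{\ell} Q(y_i\mid y_{\mathcal N_i},t_i)$, where $\mathcal N_i$ consists of $i-1$ and of the last position before $i$ with the label $t_i$ (as far as these exist), and is such that the marginal law of $Y_i$ depends only on $t_i$. (The kernel may depend on the position $i$, and on which of the two kinds of neighbours exist.) Workers are drawn independently from an unknown pool, and respond independently given the labels; the response law of a random worker (the average over the pool) is assumed to have the same structure. Write $Q_c$ for the marginal response law of a random worker to an object of class $c$, and $\delta(p,q)=\sum_y|p(y)-q(y)|$. The *distance quality* of the pool is $\min_{c\ne d}\delta(Q_c,Q_d)$. The *memory quality* is $$\min_{t^\ell}\ \tfrac12\Bigl(\min_{i} I(Y_i;Y_{\mathcal N_i})-\max_{i,\;j<i,\;j\notin\mathcal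 N_i} I(Y_i;Y_{i-1},Y_j)\Bigr),$$ where $I$ is the mutual information (in nats) under the response law of a random worker given the label sequence $t^\ell$, and where $i$ ranges, in both the minimum and the maximum, over the positions with two distinct neighbours ($|\mathcal N_i|=2$); a label sequence for which one of the index sets is empty imposes no constraint, and minima over empty sets are $+\infty$. A *scheme with $n$ responses per object* employs $n$ workers, each of whom responds to all $\ell$ objects, worker $j$ in an order $\sigma_j$ fixed by the scheme, and maps the $n\ell$ responses to a partition of the objects. Let $N_u^*(\epsilon)=N_u^*(\epsilon;\tau,\ell,\theta_d,\theta_m)$ be the least $n$ for which some scheme with $n$ responses per object outputs a partition different from $P^*(T^\ell)$ with probability less than $\epsilon$, for every prior $P_T$ and every pool with distance quality at least $\theta_d$ and memory quality at least $\theta_m$ (and $N_u^*(\epsilon)=\infty$ if there is none). **Statement.** Let $\tau\in\mathbb N$ and $\epsilon>0$. 1. For all $\theta_d,\theta_m>0$ there is a constant $C>0$ such that $N_u^*(\epsilon)\le C\log\ell$ for all $\ell\ge 2$. 2. For every $\ell>\tau^2$ there is a constant $C>0$ such that $N_u^*(\epsilon)\le C(\theta_d+\theta_m)^{-2}$ for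 all real $\theta_d,\theta_m$ with $\theta_d+\theta_m>0$. -/

import Mathlib

namespace CrowdClustering

/-- A response to an object: one of the `τ` class labels, or the null response `none`. -/
abbrev Response (τ : ℕ) : Type := Option (Fin τ)

/-- The position just before `i`, if there is one. -/
def prevIdx {ℓ : ℕ} (i : Fin ℓ) : Option (Fin ℓ) :=
  if 0 < i.val then some ⟨i.val - 1, lt_of_le_of_lt (Nat.sub_le _ _) i.isLt⟩ else none

/-- The positions before `i` that carry an object of the class of `i`. -/
def earlierSame {τ ℓ : ℕ} (t : Fin ℓ → Fin τ) (i : Fin ℓ) : Finset (Fin ℓ) :=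
  Finset.univ.filter fun j => j < i ∧ t j = t i

/-- The most recent position before `i` that carries an object of the class of `i`, if any. -/
def lastSame {τ ℓ : ℕ} (t : Fin ℓ → Fin τ) (i : Fin ℓ) : Option (Fin ℓ) :=
  if h : (earlierSame t i).Nonempty then some ((earlierSame t i).max' h) else none

/-- The neighbours of `i`: the previous position and the last position of the same class. -/
def neighbours {τ ℓ : ℕ} (t : Fin ℓ → Fin τ) (i : Fin ℓ) : Finset (Fin ℓ) :=
  (prevIdx i).toFinset ∪ (lastSame t i).toFinset

/-- The probability of the responses `y` to a sequence of objects with labels `t`, when the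
response at position `i` is drawn from the kernel `K i`, given the response at the previous
position, the last response to an object of the same class, and the label of the object. -/
noncomputable def markovLaw {τ ℓ : ℕ}
    (K : Fin ℓ → Option (Response τ) → Option (Response τ) → Fin τ → Response τ → ℝ)
    (t : Fin ℓ → Fin τ) (y : Fin ℓ → Response τ) : ℝ :=
  ∏ i, K i ((prevIdx i).map y) ((lastSame t i).map y) (t i) (y i)

/-- A worker of the unified model, on sequences of `ℓ` objects: a Markov memory kernel for which
the marginal law of the response to an object depends on the class of that object only. -/
structure Worker (τ ℓ : ℕ) where
  kernel : Fin ℓ → Option (Response τ) → Option (Response τ) → Fin τ → Response τ → ℝ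
  kernel_nonneg : ∀ i p s c a, 0 ≤ kernel i p s c a
  kernel_sum : ∀ i p s c, ∑ a, kernel i p s c a = 1
  marginal : Fin τ → Response τ → ℝ
  marginal_eq : ∀ (t : Fin ℓ → Fin τ) (i : Fin ℓ) (a : Response τ),
    ∑ y : Fin ℓ → Response τ with y i = a, markovLaw kernel t y = marginal (t i) a

/-- The law of the whole response vector of a worker, given the labels. -/
noncomputable def Worker.law {τ ℓ : ℕ} (w : Worker τ ℓ) (t : Fin ℓ → Fin τ)
    (y : Fin ℓ → Response τ) : ℝ :=
  markovLaw w.kernel t y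

/-- A pool of workers, from which workers are drawn independently with law `dist`. The response
law of a random worker (the average over the pool) again has the memory structure of a worker. -/
structure WorkerPool (τ ℓ : ℕ) where
  Index : Type
  measurableSpace : MeasurableSpace Index
  dist : MeasureTheory.Measure Index
  isProbabilityMeasure : MeasureTheory.IsProbabilityMeasure dist
  worker : Index → Worker τ ℓ
  measurable_kernel : ∀ i p s c a, Measurable fun w => (worker w).kernel i p s c a
  exists_mean_worker : ∃ v : Worker τ ℓ, ∀ t y, ∫ w, (worker w).law t y ∂dist = v.law t y

namespace WorkerPool

variable {τ ℓ : ℕ} (W : WorkerPool τ ℓ)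

/-- The response law of a random worker of the pool, given the labels. -/
noncomputable def meanLaw (t : Fin ℓ → Fin τ) (y : Fin ℓ → Response τ) : ℝ :=
  letI := W.measurableSpace
  ∫ w, (W.worker w).law t y ∂W.dist

/-- The law of the response of a random worker of the pool to an object of class `c`. -/
noncomputable def meanMarginal (c : Fin τ) (a : Response τ) : ℝ :=
  letI := W.measurableSpace
  ∫ w, (W.worker w).marginal c a ∂W.dist

end WorkerPool

/-- The total variation distance `∑ |p - q|`, the `f`-divergence for `f x = |x - 1|`. -/
def tvDist {α : Type} [Fintype α] (p q : α → ℝ) : ℝ := ∑ a, |p a - q a|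

/-- Shannon entropy, in nats, of the subvector `Y_S` of a random vector `Y` with law `p`. -/
noncomputable def entropy {τ ℓ : ℕ} (p : (Fin ℓ → Response τ) → ℝ) (S : Finset (Fin ℓ)) : ℝ :=
  ∑ z : S → Response τ,
    Real.negMulLog (∑ y : Fin ℓ → Response τ with (fun i : S => y i) = z, p y)

/-- The mutual information `I(Y_A; Y_B)` of two subvectors of a random vector with law `p`. -/
noncomputable def mutualInfo {τ ℓ : ℕ} (p : (Fin ℓ → Response τ) → ℝ)
    (A B : Finset (Fin ℓ)) : ℝ :=
  entropy p A + entropy p B - entropy p (A ∪ B)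

/-- Distance quality: the least distance between the response laws of two distinct classes. -/
noncomputable def WorkerPool.distanceQuality {τ ℓ : ℕ} (W : WorkerPool τ ℓ) : EReal :=
  ⨅ (c : Fin τ) (d : Fin τ) (_ : c ≠ d),
    ((tvDist (W.meanMarginal c) (W.meanMarginal d) : ℝ) : EReal)

/-- Memory quality for the label sequence `t`: half of
`min_i I(Y_i; Y_{N_i}) - max_{i, j} I(Y_i; Y_{i-1}, Y_j)`, where `i` ranges over the positions with
two distinct neighbours, and `j` over the positions before `i` that are not neighbours of `i`
(written as a minimum over the pairs that consist of an `i` and an `(i', j)`). -/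
noncomputable def WorkerPool.memoryQualityAt {τ ℓ : ℕ} (W : WorkerPool τ ℓ)
    (t : Fin ℓ → Fin τ) : EReal :=
  ⨅ (i : Fin ℓ) (_ : (neighbours t i).card = 2)
    (i' : Fin ℓ) (_ : (neighbours t i').card = 2)
    (j : Fin ℓ) (_ : j < i') (_ : j ∉ neighbours t i'),
    (((mutualInfo (W.meanLaw t) {i} (neighbours t i)
      - mutualInfo (W.meanLaw t) {i'} ((prevIdx i').toFinset ∪ {j})) / 2 : ℝ) : EReal)

/-- Memory quality of a pool: the worst case over the label sequences. -/
noncomputable def WorkerPool.memoryQuality {τ ℓ : ℕ} (W : WorkerPool τ ℓ) : EReal :=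
  ⨅ t : Fin ℓ → Fin τ, W.memoryQualityAt t

/-- A clustering scheme with `n` responses per object: `n` workers respond to all `ℓ` objects, the
`j`-th one in the order `order j` (the object at position `i` is `order j i`), and the decoder maps
the responses (worker `j`, position `i`) to a partition of the objects. -/
structure Scheme (τ ℓ n : ℕ) where
  order : Fin n → Equiv.Perm (Fin ℓ)
  decode : (Fin n → Fin ℓ → Response τ) → Setoid (Fin ℓ)

open Classical in
/-- The probability that the decoder does not output the correct clustering (two objects are
together if and only if their labels agree), when labels are i.i.d. with law `P` and the workers
are drawn independently from the pool `W`. -/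
noncomputable def Scheme.errorProb {τ ℓ n : ℕ} (Φ : Scheme τ ℓ n) (W : WorkerPool τ ℓ)
    (P : Fin τ → ℝ) : ℝ :=
  ∑ t : Fin ℓ → Fin τ, (∏ i, P (t i)) *
    ∑ Y : Fin n → Fin ℓ → Response τ with Φ.decode Y ≠ Setoid.ker t,
      ∏ j, W.meanLaw (t ∘ Φ.order j) (Y j)

/-- Sample complexity of universal clustering under the unified worker model: the least number of
responses per object for which one scheme has error probability below `ε` for every prior and
every pool of workers with distance quality at least `θd` and memory quality at least `θm`
(`⊤` if there is no such number). -/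
noncomputable def sampleComplexity (τ ℓ : ℕ) (ε θd θm : ℝ) : ℕ∞ :=
  ⨅ (n : ℕ) (_ : ∃ Φ : Scheme τ ℓ n, ∀ W : WorkerPool τ ℓ,
      (θd : EReal) ≤ W.distanceQuality → (θm : EReal) ≤ W.memoryQuality →
      ∀ P ∈ stdSimplex ℝ (Fin τ), Φ.errorProb W P < ε), (n : ℕ∞)

end CrowdClustering

/-!
Both bounds come from explicit schemes, and every probability is a finite sum over the responses
of independent workers, each with the response law of a random worker of the pool.

*Distance.* If all workers use the same order, then the responses to an object of class `c` are an
independent sample from the marginal law `Q_c`. By Hoeffding's inequality and a union bound over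
the `ℓ (τ + 1)` pairs of an object and a response, all empirical laws are within `θd / 4` of the
true ones, in total variation, once the number of workers is of order `log ℓ / θd ^ 2`. Then two
objects belong together if and only if their empirical laws are closer than `θd / 2`
(`decode_distanceScheme`, `prodProb_distanceScheme_le`). This gives the first bound, and the second
one when `θm ≤ θd`.

*Memory.* Consider the last position `i` of an order, and compare the informations
`I(Y_i; Y_{i-1}, Y_j)` for `j < i - 1`. If the last two objects are of different classes, and the
class of the last one has occurred before, then the last such occurrence beats all other `j` by
twice the memory quality (`WorkerPool.lastInfo_gap`). Otherwise `Y_i` depends on the past through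
`Y_{i-1}` only, and all `j` are equal (`WorkerPool.lastInfo_eq`). So a `j` that clearly beats all
others identifies an object of the class of the last one (`detects_iff`). If all orders are used,
then every pair of objects of one class is found in this way as soon as there is an object of
another class (`exists_detects`); and if no order reveals anything, then there is one class only,
because `ℓ > τ` forces two objects to share a class (`memoryDecode_eq`).

The informations are estimated by plugging in the empirical law. The error of the plug-in entropy
is at most a sample mean of the centred `-log q` plus a `χ²`-divergence
(`abs_sum_negMulLog_sub_le`). Since `x (log x) ^ 2` is bounded on `[0, 1]`, the moments of both
terms are controlled by the size of the alphabet alone, so Markov's inequality yields a sample size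
of order `θm ^ (-2)` without logarithmic factors (`prodProb_entropy_ge_le`).

Both qualities are bounded for `2 ≤ τ` and `4 ≤ ℓ`, so that no pool meets a large requirement, and
then no response is needed at all; for `τ ≤ 1` there is one clustering only.
-/

namespace CrowdClustering

open Finset

/-! ### Product laws on finite types -/

section ProductLaws

variable {ι α : Type*} [Fintype ι] [DecidableEq ι] [Fintype α]

open Classical in
/-- The probability of the event `E` for independent responses `Y j`, the `j`-th with law `p j`. -/
noncomputable def prodProb (p : ι → α → ℝ) (E : (ι → α) → Prop) : ℝ :=
  ∑ Y : ι → α with E Y, ∏ j, p j (Y j)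

lemma sum_prod_pi (F : ι → α → ℝ) : ∑ Y : ι → α, ∏ j, F j (Y j) = ∏ j, ∑ a, F j a := by
  classical
  rw [Finset.prod_univ_sum, Fintype.piFinset_univ]

/-- It suffices to compare the events on the support of the product law. -/
lemma prodProb_mono {p : ι → α → ℝ} (hp : ∀ j a, 0 ≤ p j a) {E F : (ι → α) → Prop}
    (h : ∀ Y, (∀ j, p j (Y j) ≠ 0) → E Y → F Y) : prodProb p E ≤ prodProb p F := by
  classical
  unfold prodProb
  rw [Finset.sum_filter, Finset.sum_filter]
  refine Finset.sum_le_sum fun Y _ => ?_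
  have h0 : 0 ≤ ∏ j, p j (Y j) := Finset.prod_nonneg fun j _ => hp j _
  by_cases hE : E Y
  · by_cases hY : ∀ j, p j (Y j) ≠ 0
    · simp [hE, h Y hY hE]
    · push Not at hY
      obtain ⟨j, hj⟩ := hY
      have : ∏ j, p j (Y j) = 0 := Finset.prod_eq_zero (Finset.mem_univ j) hj
      simp [this]
  · simp only [hE, if_false]
    split_ifs <;> simp [h0]

lemma prodProb_exists_le {κ : Type*} [Fintype κ] {p : ι → α → ℝ} (hp : ∀ j a, 0 ≤ p j a)
    (E : κ → (ι → α) → Prop) :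
    prodProb p (fun Y => ∃ k, E k Y) ≤ ∑ k, prodProb p (E k) := by
  classical
  unfold prodProb
  simp_rw [Finset.sum_filter]
  rw [Finset.sum_comm]
  refine Finset.sum_le_sum fun Y _ => ?_
  have h0 : 0 ≤ ∏ j, p j (Y j) := Finset.prod_nonneg fun j _ => hp j _
  have h1 : ∀ k, 0 ≤ if E k Y then ∏ j, p j (Y j) else 0 := fun k => by split_ifs <;> simp [h0]
  split_ifs with h
  · obtain ⟨k, hk⟩ := h
    refine le_trans ?_ (Finset.single_le_sum (fun k _ => h1 k) (Finset.mem_univ k))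
    simp [hk]
  · exact Finset.sum_nonneg fun k _ => h1 k

lemma prodProb_or_le {p : ι → α → ℝ} (hp : ∀ j a, 0 ≤ p j a) (E F : (ι → α) → Prop) :
    prodProb p (fun Y => E Y ∨ F Y) ≤ prodProb p E + prodProb p F := by
  have h := prodProb_exists_le hp (fun b : Bool => if b then E else F)
  simpa [or_comm] using h

/-- Markov's inequality. -/
lemma mul_prodProb_le {p : ι → α → ℝ} (hp : ∀ j a, 0 ≤ p j a) (X : (ι → α) → ℝ)
    (hX : ∀ Y, 0 ≤ X Y) (c : ℝ) :
    c * prodProb p (fun Y => c ≤ X Y) ≤ ∑ Y : ι → α, (∏ j, p j (Y j)) * X Y := by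
  classical
  unfold prodProb
  rw [Finset.sum_filter, Finset.mul_sum]
  refine Finset.sum_le_sum fun Y _ => ?_
  have h0 : 0 ≤ ∏ j, p j (Y j) := Finset.prod_nonneg fun j _ => hp j _
  split_ifs with h
  · nlinarith
  · simpa using mul_nonneg h0 (hX Y)

/-- Hoeffding's lemma for a centred variable with values in `[-1, 1]`. -/
lemma sum_mul_exp_le {q : α → ℝ} (hq : ∀ a, 0 ≤ q a) (hq1 : ∑ a, q a = 1) {h : α → ℝ}
    (hh : ∀ a, |h a| ≤ 1) (h0 : ∑ a, q a * h a = 0) (x : ℝ) :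
    ∑ a, q a * Real.exp (x * h a) ≤ Real.exp (x ^ 2 / 2) := by
  -- the chord of the convex function `exp` over `[-x, x]`
  have key : ∀ a, Real.exp (x * h a) ≤ Real.cosh x + h a * Real.sinh x := by
    intro a
    obtain ⟨h1, h2⟩ := abs_le.mp (hh a)
    have := convexOn_exp.2 (Set.mem_univ x) (Set.mem_univ (-x))
      (show 0 ≤ (1 + h a) / 2 by linarith) (show 0 ≤ (1 - h a) / 2 by linarith) (by ring)
    simp only [smul_eq_mul] at this
    rw [Real.cosh_eq, Real.sinh_eq]
    refine le_trans (le_of_eq (by ring_nf)) (this.trans (le_of_eq (by ring)))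
  calc ∑ a, q a * Real.exp (x * h a)
      ≤ ∑ a, q a * (Real.cosh x + h a * Real.sinh x) :=
        Finset.sum_le_sum fun a _ => mul_le_mul_of_nonneg_left (key a) (hq a)
    _ = (∑ a, q a) * Real.cosh x + (∑ a, q a * h a) * Real.sinh x := by
        rw [Finset.sum_mul, Finset.sum_mul, ← Finset.sum_add_distrib]
        exact Finset.sum_congr rfl fun a _ => by ring
    _ = Real.cosh x := by rw [hq1, h0]; ring
    _ ≤ _ := Real.cosh_le_exp_half_sq x

/-- Hoeffding's inequality, upper tail. -/
lemma prodProb_sum_ge_le {p : ι → α → ℝ} (hp : ∀ j a, 0 ≤ p j a) (hp1 : ∀ j, ∑ a, p j a = 1)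
    {h : ι → α → ℝ} (hh : ∀ j a, |h j a| ≤ 1) (h0 : ∀ j, ∑ a, p j a * h j a = 0) (η : ℝ)
    (hη : 0 ≤ η) :
    prodProb p (fun Y => Fintype.card ι * η ≤ ∑ j, h j (Y j))
      ≤ Real.exp (-(Fintype.card ι * η ^ 2 / 2)) := by
  set N : ℝ := (Fintype.card ι : ℝ)
  have h1 := mul_prodProb_le hp (fun Y => Real.exp (∑ j, η * h j (Y j)))
    (fun Y => (Real.exp_pos _).le) (Real.exp (N * η ^ 2))
  have h2 : ∑ Y : ι → α, (∏ j, p j (Y j)) * Real.exp (∑ j, η * h j (Y j))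
      ≤ Real.exp (N * (η ^ 2 / 2)) := by
    simp_rw [Real.exp_sum, ← Finset.prod_mul_distrib]
    rw [sum_prod_pi (fun j a => p j a * Real.exp (η * h j a))]
    calc _ ≤ ∏ _j : ι, Real.exp (η ^ 2 / 2) :=
          Finset.prod_le_prod (fun j _ => Finset.sum_nonneg fun a _ =>
            mul_nonneg (hp j a) (Real.exp_pos _).le)
            fun j _ => sum_mul_exp_le (hp j) (hp1 j) (hh j) (h0 j) η
      _ = _ := by
          rw [Finset.prod_const, ← Real.exp_nat_mul, Finset.card_univ]
  have h3 : prodProb p (fun Y => N * η ≤ ∑ j, h j (Y j)) ≤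
      prodProb p (fun Y => Real.exp (N * η ^ 2) ≤ Real.exp (∑ j, η * h j (Y j))) := by
    refine prodProb_mono hp fun Y _ hY => Real.exp_le_exp.mpr ?_
    rw [← Finset.mul_sum]
    nlinarith
  have h4 := h1.trans h2
  refine h3.trans ?_
  have h5 : -(N * η ^ 2 / 2) = N * (η ^ 2 / 2) - N * η ^ 2 := by ring
  rw [h5, Real.exp_sub, le_div_iff₀ (Real.exp_pos _), mul_comm]
  exact h4

/-- Hoeffding's inequality, both tails. -/
lemma prodProb_abs_sum_ge_le {p : ι → α → ℝ} (hp : ∀ j a, 0 ≤ p j a)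
    (hp1 : ∀ j, ∑ a, p j a = 1) {h : ι → α → ℝ} (hh : ∀ j a, |h j a| ≤ 1)
    (h0 : ∀ j, ∑ a, p j a * h j a = 0) (η : ℝ) (hη : 0 ≤ η) :
    prodProb p (fun Y => Fintype.card ι * η ≤ |∑ j, h j (Y j)|)
      ≤ 2 * Real.exp (-(Fintype.card ι * η ^ 2 / 2)) := by
  have h1 := prodProb_sum_ge_le hp hp1 hh h0 η hη
  have h2 := prodProb_sum_ge_le (h := fun j a => -h j a) hp hp1 (by simpa using hh)
    (by simpa using h0) η hη
  have h3 := prodProb_or_le hp (fun Y => Fintype.card ι * η ≤ ∑ j, h j (Y j))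
    (fun Y => Fintype.card ι * η ≤ ∑ j, -h j (Y j))
  have h4 : prodProb p (fun Y => Fintype.card ι * η ≤ |∑ j, h j (Y j)|) ≤ _ :=
    prodProb_mono hp fun Y _ hY => by
      rw [le_abs, ← Finset.sum_neg_distrib] at hY
      exact hY
  linarith

/-- The variance of a sum of independent centred variables is the sum of the variances. -/
lemma sum_prod_mul_sq_sum {p : ι → α → ℝ} (hp1 : ∀ j, ∑ a, p j a = 1) (s : Finset ι)
    {h : ι → α → ℝ} (h0 : ∀ j ∈ s, ∑ a, p j a * h j a = 0) :
    ∑ Y : ι → α, (∏ j, p j (Y j)) * (∑ j ∈ s, h j (Y j)) ^ 2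
      = ∑ j ∈ s, ∑ a, p j a * h j a ^ 2 := by
  classical
  have key : ∀ j ∈ s, ∀ k ∈ s, ∑ Y : ι → α, (∏ i, p i (Y i)) * (h j (Y j) * h k (Y k))
      = if j = k then ∑ a, p j a * h j a ^ 2 else 0 := by
    intro j hj k hk
    have h1 : ∀ Y : ι → α, (∏ i, p i (Y i)) * (h j (Y j) * h k (Y k))
        = ∏ i, p i (Y i) * ((if i = j then h i (Y i) else 1) *
            (if i = k then h i (Y i) else 1)) := by
      intro Y
      rw [Finset.prod_mul_distrib, Finset.prod_mul_distrib]
      simp [Finset.prod_ite_eq']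
    simp_rw [h1]
    rw [sum_prod_pi (fun i a => p i a * ((if i = j then h i a else 1) *
      (if i = k then h i a else 1)))]
    split_ifs with hjk
    · subst hjk
      rw [Finset.prod_eq_single j]
      · simp [sq]
      · intro i _ hi
        simp [hi, hp1]
      · simp
    · apply Finset.prod_eq_zero (Finset.mem_univ j)
      simp [hjk, h0 j hj]
  calc _ = ∑ Y : ι → α, ∑ j ∈ s, ∑ k ∈ s, (∏ i, p i (Y i)) * (h j (Y j) * h k (Y k)) := by
        refine Finset.sum_congr rfl fun Y _ => ?_
        rw [sq, Finset.sum_mul_sum, Finset.mul_sum]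
        exact Finset.sum_congr rfl fun j _ => by rw [Finset.mul_sum]
    _ = ∑ j ∈ s, ∑ k ∈ s, ∑ Y : ι → α, (∏ i, p i (Y i)) * (h j (Y j) * h k (Y k)) := by
        rw [Finset.sum_comm]
        exact Finset.sum_congr rfl fun j _ => Finset.sum_comm
    _ = _ := by
        refine Finset.sum_congr rfl fun j hj => ?_
        rw [Finset.sum_congr rfl fun k hk => key j hj k hk]
        simp [hj]

/-- The variance of the mean over the sample `s` of a centred function. -/
lemma sum_prod_mul_sq_mean {p : ι → α → ℝ} (hp1 : ∀ j, ∑ a, p j a = 1) {s : Finset ι}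
    (hs : s.Nonempty) {q : α → ℝ} (hq : ∀ j ∈ s, p j = q)
    {h : α → ℝ} (h0 : ∑ a, q a * h a = 0) :
    ∑ Y : ι → α, (∏ j, p j (Y j)) * ((s.card : ℝ)⁻¹ * ∑ j ∈ s, h (Y j)) ^ 2
      = (s.card : ℝ)⁻¹ * ∑ a, q a * h a ^ 2 := by
  have h1 := sum_prod_mul_sq_sum hp1 s (h := fun _ => h) (fun j hj => by rw [hq j hj, h0])
  have h2 : ∑ j ∈ s, ∑ a, p j a * h a ^ 2 = s.card * ∑ a, q a * h a ^ 2 := by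
    rw [Finset.sum_congr rfl fun j hj => by rw [hq j hj]]
    simp
  have h3 : (s.card : ℝ) ≠ 0 := by exact_mod_cast hs.card_pos.ne'
  simp_rw [mul_pow, mul_left_comm _ ((s.card : ℝ)⁻¹ ^ 2), ← Finset.mul_sum]
  rw [h1, h2]
  field_simp

end ProductLaws

/-! ### Concentration of the empirical entropy -/

section Entropy

variable {β : Type*} [Fintype β]

/-- The entropy error of `r` is at most a linear term plus the `χ²`-divergence of `r` from `q`. -/
lemma abs_sum_negMulLog_sub_le {q r : β → ℝ} (hq : ∀ b, 0 ≤ q b) (hr : ∀ b, 0 ≤ r b)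
    (hqr : ∑ b, r b = ∑ b, q b) (hac : ∀ b, q b = 0 → r b = 0) :
    |∑ b, Real.negMulLog (r b) - ∑ b, Real.negMulLog (q b)|
      ≤ |∑ b, (r b - q b) * Real.log (q b)| + ∑ b, (r b - q b) ^ 2 / q b := by
  -- the entropy difference is minus the linear term minus the Kullback-Leibler divergence
  have e : ∑ b, Real.negMulLog (r b) - ∑ b, Real.negMulLog (q b)
      = -∑ b, (r b - q b) * Real.log (q b) - ∑ b, r b * (Real.log (r b) - Real.log (q b)) := by
    rw [← Finset.sum_sub_distrib, ← Finset.sum_neg_distrib, ← Finset.sum_sub_distrib]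
    refine Finset.sum_congr rfl fun b _ => ?_
    simp only [Real.negMulLog]
    ring
  have lo : ∑ b, (r b - q b) ≤ ∑ b, r b * (Real.log (r b) - Real.log (q b)) := by
    refine Finset.sum_le_sum fun b _ => ?_
    rcases (hr b).eq_or_lt with h | h
    · rw [← h]; simpa using hq b
    · have hqb : 0 < q b := lt_of_le_of_ne (hq b) fun h' => h.ne' (hac b h'.symm)
      have := Real.log_le_sub_one_of_pos (div_pos hqb h)
      rw [Real.log_div hqb.ne' h.ne'] at this
      have h3 := mul_le_mul_of_nonneg_left this h.le
      have h4 : r b * (q b / r b - 1) = q b - r b := by field_simp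
      nlinarith
  have hi : ∑ b, r b * (Real.log (r b) - Real.log (q b))
      ≤ ∑ b, ((r b - q b) ^ 2 / q b + (r b - q b)) := by
    refine Finset.sum_le_sum fun b _ => ?_
    rcases (hr b).eq_or_lt with h | h
    · rw [← h]
      rcases (hq b).eq_or_lt with h' | h'
      · simp [← h']
      · have : (0 - q b) ^ 2 / q b = q b := by field_simp; ring
        rw [this]; simp
    · have hqb : 0 < q b := lt_of_le_of_ne (hq b) fun h' => h.ne' (hac b h'.symm)
      have := Real.log_le_sub_one_of_pos (div_pos h hqb)
      rw [Real.log_div h.ne' hqb.ne'] at this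
      have h3 := mul_le_mul_of_nonneg_left this h.le
      have h4 : r b * (r b / q b - 1) = (r b - q b) ^ 2 / q b + (r b - q b) := by
        field_simp; ring
      linarith
  rw [Finset.sum_add_distrib] at hi
  have hz : ∑ b, (r b - q b) = 0 := by rw [Finset.sum_sub_distrib, hqr, sub_self]
  rw [hz] at lo hi
  rw [e]
  have := abs_sub (-∑ b, (r b - q b) * Real.log (q b))
    (∑ b, r b * (Real.log (r b) - Real.log (q b)))
  rw [abs_neg, abs_of_nonneg lo] at this
  linarith

lemma mul_log_sq_le {x : ℝ} (h0 : 0 ≤ x) (h1 : x ≤ 1) : x * Real.log x ^ 2 ≤ 4 := by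
  rcases h0.eq_or_lt with h | h
  · simp [← h]
  · have h2 := Real.abs_log_mul_self_lt (√x) (Real.sqrt_pos.mpr h) (Real.sqrt_le_one.mpr h1)
    rw [Real.log_sqrt h0] at h2
    have h3 := (sq_lt_one_iff_abs_lt_one _).mpr h2
    have h4 := Real.sq_sqrt h0
    have : (Real.log x / 2 * √x) ^ 2 = x * Real.log x ^ 2 / 4 := by
      rw [mul_pow, h4]; ring
    linarith

/-- The integral of `f` against the empirical law of the sample `x` is the sample mean of `f`. -/
lemma sum_mean_mul {ι : Type*} [DecidableEq β] (s : Finset ι) (x : ι → β) (f : β → ℝ) :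
    ∑ b, ((s.card : ℝ)⁻¹ * ∑ j ∈ s, if x j = b then 1 else 0) * f b
      = (s.card : ℝ)⁻¹ * ∑ j ∈ s, f (x j) := by
  simp_rw [mul_assoc, ← Finset.mul_sum, Finset.sum_mul]
  rw [Finset.sum_comm]
  simp

variable {ι α : Type*} [Fintype ι] [DecidableEq ι] [Fintype α] [DecidableEq β]

/-- The plug-in estimate of the entropy of `g (Y j)` from the sample `s` has error of order
`1 / √|s|`, with a constant that depends on the number of values of `g` only. -/
lemma prodProb_entropy_ge_le {p : ι → α → ℝ} (hp : ∀ j a, 0 ≤ p j a)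
    (hp1 : ∀ j, ∑ a, p j a = 1) {s : Finset ι} (hs : s.Nonempty) {u : α → ℝ}
    (hu : ∀ j ∈ s, p j = u) (g : α → β) {η : ℝ} (hη : 0 < η) :
    prodProb p (fun Y => η ≤
        |∑ b, Real.negMulLog ((s.card : ℝ)⁻¹ * ∑ j ∈ s, if g (Y j) = b then 1 else 0)
          - ∑ b, Real.negMulLog (∑ a with g a = b, u a)|)
      ≤ Fintype.card β * (16 / η ^ 2 + 2 / η) / s.card := by
  classical
  obtain ⟨j₀, hj₀⟩ := hs
  have hs : s.Nonempty := ⟨j₀, hj₀⟩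
  have hN : (0 : ℝ) < s.card := by exact_mod_cast hs.card_pos
  have hu0 : ∀ a, 0 ≤ u a := by rw [← hu j₀ hj₀]; exact hp j₀
  have hu1 : ∑ a, u a = 1 := by rw [← hu j₀ hj₀]; exact hp1 j₀
  set q : β → ℝ := fun b => ∑ a with g a = b, u a with hq
  set r : (ι → α) → β → ℝ :=
    fun Y b => (s.card : ℝ)⁻¹ * ∑ j ∈ s, if g (Y j) = b then 1 else 0 with hr
  have hq0 : ∀ b, 0 ≤ q b := fun b => Finset.sum_nonneg fun a _ => hu0 a
  have push : ∀ f : β → ℝ, ∑ a, u a * f (g a) = ∑ b, q b * f b := by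
    intro f
    simp only [hq, Finset.sum_mul, Finset.sum_filter, ite_mul, zero_mul]
    rw [Finset.sum_comm]
    simp
  have hq1 : ∑ b, q b = 1 := by simpa [hu1] using (push fun _ => 1).symm
  have hqle : ∀ b, q b ≤ 1 := fun b => by
    rw [← hq1]; exact Finset.single_le_sum (fun b _ => hq0 b) (Finset.mem_univ b)
  have hr0 : ∀ Y b, 0 ≤ r Y b := fun Y b => mul_nonneg (by positivity)
    (Finset.sum_nonneg fun j _ => by split_ifs <;> simp)
  have hr1 : ∀ Y, ∑ b, r Y b = 1 := by
    intro Y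
    have := sum_mean_mul s (fun j => g (Y j)) (fun _ => 1)
    simp only [mul_one, Finset.sum_const, nsmul_eq_mul] at this
    rw [hr]
    rw [this, inv_mul_cancel₀ hN.ne']
  -- the linear term
  set m : ℝ := ∑ b, q b * Real.log (q b) with hm
  set h : α → ℝ := fun a => Real.log (q (g a)) - m with hh
  have hL : ∀ Y, ∑ b, (r Y b - q b) * Real.log (q b)
      = (s.card : ℝ)⁻¹ * ∑ j ∈ s, h (Y j) := by
    intro Y
    simp only [sub_mul, Finset.sum_sub_distrib, hh, hr, mul_sub, Finset.sum_const, nsmul_eq_mul]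
    rw [sum_mean_mul s (fun j => g (Y j)) (fun b => Real.log (q b)), inv_mul_cancel_left₀ hN.ne']
  have hh0 : ∑ a, u a * h a = 0 := by
    rw [push fun b => Real.log (q b) - m]
    simp only [mul_sub, Finset.sum_sub_distrib]
    rw [← Finset.sum_mul, hq1, ← hm]; ring
  have hh2 : ∑ a, u a * h a ^ 2 ≤ 4 * Fintype.card β := by
    have e1 : ∑ a, u a * h a ^ 2 = ∑ b, q b * Real.log (q b) ^ 2 - m ^ 2 := by
      rw [push fun b => (Real.log (q b) - m) ^ 2]
      have : ∀ b, q b * (Real.log (q b) - m) ^ 2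
          = q b * Real.log (q b) ^ 2 - 2 * m * (q b * Real.log (q b)) + m ^ 2 * q b :=
        fun b => by ring
      simp_rw [this, Finset.sum_add_distrib, Finset.sum_sub_distrib, ← Finset.mul_sum]
      rw [hq1, ← hm]; ring
    have e2 : ∑ b, q b * Real.log (q b) ^ 2 ≤ ∑ _b : β, (4 : ℝ) :=
      Finset.sum_le_sum fun b _ => mul_log_sq_le (hq0 b) (hqle b)
    simp at e2
    nlinarith [sq_nonneg m]
  have hA : prodProb p (fun Y => (η / 2) ^ 2 ≤ (∑ b, (r Y b - q b) * Real.log (q b)) ^ 2)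
      ≤ Fintype.card β * (16 / η ^ 2) / s.card := by
    have h1 := mul_prodProb_le hp (fun Y => (∑ b, (r Y b - q b) * Real.log (q b)) ^ 2)
      (fun Y => sq_nonneg _) ((η / 2) ^ 2)
    have h2 : ∑ Y : ι → α, (∏ j, p j (Y j)) * (∑ b, (r Y b - q b) * Real.log (q b)) ^ 2
        ≤ (s.card : ℝ)⁻¹ * (4 * Fintype.card β) := by
      simp_rw [hL]
      rw [sum_prod_mul_sq_mean hp1 hs hu hh0]
      exact mul_le_mul_of_nonneg_left hh2 (by positivity)
    have h3 := h1.trans h2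
    rw [← le_div_iff₀' (by positivity)] at h3
    refine h3.trans (le_of_eq ?_)
    field_simp
    ring
  -- the `χ²` term
  have hB : prodProb p (fun Y => η / 2 ≤ ∑ b, (r Y b - q b) ^ 2 / q b)
      ≤ Fintype.card β * (2 / η) / s.card := by
    have h1 := mul_prodProb_le hp (fun Y => ∑ b, (r Y b - q b) ^ 2 / q b)
      (fun Y => Finset.sum_nonneg fun b _ => div_nonneg (sq_nonneg _) (hq0 b)) (η / 2)
    have h2 : ∑ Y : ι → α, (∏ j, p j (Y j)) * (∑ b, (r Y b - q b) ^ 2 / q b)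
        ≤ (s.card : ℝ)⁻¹ * Fintype.card β := by
      simp_rw [Finset.mul_sum]
      rw [Finset.sum_comm]
      have : ∀ b, ∑ Y : ι → α, (∏ j, p j (Y j)) * ((r Y b - q b) ^ 2 / q b)
          ≤ (s.card : ℝ)⁻¹ := by
        intro b
        set k : α → ℝ := fun a => (if g a = b then 1 else 0) - q b with hk
        have e1 : ∀ Y, r Y b - q b = (s.card : ℝ)⁻¹ * ∑ j ∈ s, k (Y j) := by
          intro Y
          simp only [hk, hr, Finset.sum_sub_distrib, mul_sub, Finset.sum_const, nsmul_eq_mul]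
          rw [inv_mul_cancel_left₀ hN.ne']
        have e2 : ∑ a, u a * k a = 0 := by
          rw [push fun b' => (if b' = b then 1 else 0) - q b]
          simp only [mul_sub, Finset.sum_sub_distrib, ← Finset.sum_mul, hq1]
          simp
        have e3 : ∑ a, u a * k a ^ 2 ≤ q b := by
          rw [push fun b' => ((if b' = b then 1 else 0) - q b) ^ 2]
          have : ∀ b', q b' * ((if b' = b then 1 else 0) - q b) ^ 2
              = (1 - 2 * q b) * (if b' = b then q b' else 0) + q b ^ 2 * q b' := by
            intro b'; split_ifs <;> ring
          simp_rw [this, Finset.sum_add_distrib, ← Finset.mul_sum]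
          rw [hq1]
          simp
          nlinarith [sq_nonneg (q b)]
        have e4 := sum_prod_mul_sq_mean hp1 hs hu e2
        simp_rw [e1, mul_div_assoc', ← Finset.sum_div]
        rw [e4]
        rcases (hq0 b).eq_or_lt with h' | h'
        · rw [← h']; simp
        · rw [div_le_iff₀ h']
          exact mul_le_mul_of_nonneg_left e3 (by positivity)
      calc _ ≤ ∑ _b : β, (s.card : ℝ)⁻¹ := Finset.sum_le_sum fun b _ => this b
        _ = _ := by simp [mul_comm]
    have h3 := h1.trans h2
    rw [← le_div_iff₀' (by positivity)] at h3
    refine h3.trans (le_of_eq ?_)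
    field_simp
  have hC := prodProb_or_le hp
    (fun Y => (η / 2) ^ 2 ≤ (∑ b, (r Y b - q b) * Real.log (q b)) ^ 2)
    (fun Y => η / 2 ≤ ∑ b, (r Y b - q b) ^ 2 / q b)
  refine (prodProb_mono hp fun Y hY hE => ?_).trans (hC.trans ((add_le_add hA hB).trans_eq ?_))
  · have hac : ∀ b, q b = 0 → r Y b = 0 := by
      intro b hb
      simp only [hr]
      rw [Finset.sum_eq_zero, mul_zero]
      intro j hj
      rw [if_neg]
      intro hg
      have := (Finset.sum_eq_zero_iff_of_nonneg (fun a _ => hu0 a)).mp hb (Y j) (by simp [hg])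
      exact hY j (by rw [hu j hj, this])
    have hd := abs_sum_negMulLog_sub_le hq0 (hr0 Y) ((hr1 Y).trans hq1.symm) hac
    by_contra hcon
    push Not at hcon
    have h1 := abs_lt_of_sq_lt_sq hcon.1 (by positivity)
    have h2 : η ≤ _ := hE
    linarith [hcon.2]
  · ring

end Entropy

/-! ### The Markov memory structure -/

/-- Resampling one coordinate uniformly preserves the uniform average. -/
lemma sum_sum_update {ι A : Type*} [Fintype ι] [DecidableEq ι] [Fintype A] (i : ι)
    (G : (ι → A) → ℝ) :
    ∑ y : ι → A, ∑ b, G (Function.update y i b) = Fintype.card A * ∑ y : ι → A, G y := by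
  let e : (ι → A) × A ≃ (ι → A) × A :=
    { toFun := fun x => (Function.update x.1 i x.2, x.1 i)
      invFun := fun x => (Function.update x.1 i x.2, x.1 i)
      left_inv := fun x => by simp
      right_inv := fun x => by simp }
  have h := e.sum_comp (fun x => G x.1)
  rw [Fintype.sum_prod_type, Fintype.sum_prod_type] at h
  simpa [e, Finset.mul_sum] using h

section Neighbours

variable {τ ℓ : ℕ}

lemma lt_of_prevIdx_eq_some {i j : Fin ℓ} (h : prevIdx i = some j) : j < i := by
  unfold prevIdx at h
  split_ifs at h with h0
  cases h
  simp only [Fin.lt_def]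
  omega

lemma lastSame_eq_some_iff {t : Fin ℓ → Fin τ} {i j : Fin ℓ} :
    lastSame t i = some j ↔ j < i ∧ t j = t i ∧ ∀ k, k < i → t k = t i → k ≤ j := by
  unfold lastSame
  split_ifs with h
  · rw [Option.some_inj, Finset.max'_eq_iff]
    simp [earlierSame, and_assoc]
  · simp only [false_iff]
    rintro ⟨h1, h2, -⟩
    exact h ⟨j, by simp [earlierSame, h1, h2]⟩

lemma lt_of_lastSame_eq_some {t : Fin ℓ → Fin τ} {i j : Fin ℓ} (h : lastSame t i = some j) :
    j < i := (lastSame_eq_some_iff.mp h).1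

lemma map_update_of_lt {A : Type*} {o : Option (Fin ℓ)} {i i₀ : Fin ℓ}
    (ho : ∀ j, o = some j → j < i) (hi : i ≤ i₀) (y : Fin ℓ → A) (b : A) :
    o.map (Function.update y i₀ b) = o.map y := by
  cases o with
  | none => rfl
  | some j =>
    have : j ≠ i₀ := ((ho j rfl).trans_le hi).ne
    simp [this]

lemma markov_factor_update
    (K : Fin ℓ → Option (Response τ) → Option (Response τ) → Fin τ → Response τ → ℝ)
    (t : Fin ℓ → Fin τ) {i i₀ : Fin ℓ} (hi : i < i₀) (y : Fin ℓ → Response τ) (b : Response τ) :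
    K i ((prevIdx i).map (Function.update y i₀ b)) ((lastSame t i).map (Function.update y i₀ b))
        (t i) (Function.update y i₀ b i)
      = K i ((prevIdx i).map y) ((lastSame t i).map y) (t i) (y i) := by
  rw [map_update_of_lt (fun j => lt_of_prevIdx_eq_some) hi.le,
    map_update_of_lt (fun j => lt_of_lastSame_eq_some) hi.le, Function.update_of_ne hi.ne]

/-- The Markov law has total mass one: sum out the positions, the last one first. -/
lemma sum_markovLaw
    {K : Fin ℓ → Option (Response τ) → Option (Response τ) → Fin τ → Response τ → ℝ}
    (hK : ∀ i p s c, ∑ a, K i p s c a = 1) (t : Fin ℓ → Fin τ) :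
    ∑ y, markovLaw K t y = 1 := by
  set F : Fin ℓ → (Fin ℓ → Response τ) → ℝ :=
    fun i y => K i ((prevIdx i).map y) ((lastSame t i).map y) (t i) (y i) with hF
  set N : ℝ := (Fintype.card (Response τ) : ℝ) with hN
  have hN0 : N ≠ 0 := by rw [hN]; exact_mod_cast Fintype.card_ne_zero
  have key : ∀ m ≤ ℓ, N ^ m * ∑ y : Fin ℓ → Response τ, ∏ i with i.val < m, F i y = N ^ ℓ := by
    intro m
    induction m with
    | zero => intro _; simp [hN]
    | succ m ih =>
      intro hm
      have hm' : m < ℓ := hm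
      let i₀ : Fin ℓ := ⟨m, hm'⟩
      have hs : (univ.filter fun i : Fin ℓ => i.val < m + 1)
          = insert i₀ (univ.filter fun i : Fin ℓ => i.val < m) := by
        ext i
        simp only [mem_filter, mem_univ, true_and, mem_insert, i₀, Fin.ext_iff]
        omega
      have h1 := sum_sum_update i₀ (fun y : Fin ℓ → Response τ => ∏ i with i.val < m + 1, F i y)
      have h2 : ∀ y : Fin ℓ → Response τ,
          ∑ b, ∏ i with i.val < m + 1, F i (Function.update y i₀ b)
            = ∏ i with i.val < m, F i y := by
        intro y
        have h3 : ∀ b, ∏ i with i.val < m + 1, F i (Function.update y i₀ b)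
            = K i₀ ((prevIdx i₀).map y) ((lastSame t i₀).map y) (t i₀) b
              * ∏ i with i.val < m, F i y := by
          intro b
          rw [hs, Finset.prod_insert (by simp [i₀])]
          congr 1
          · simp only [hF]
            rw [map_update_of_lt (fun j => lt_of_prevIdx_eq_some) le_rfl,
              map_update_of_lt (fun j => lt_of_lastSame_eq_some) le_rfl, Function.update_self]
          · refine Finset.prod_congr rfl fun i hi => ?_
            exact markov_factor_update K t (by simpa [i₀, Fin.lt_def] using hi) y b
        simp_rw [h3]
        rw [← Finset.sum_mul, hK, one_mul]
      simp_rw [h2] at h1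
      rw [pow_succ, mul_assoc, ← h1]
      exact ih hm'.le
  have h := key ℓ le_rfl
  have hf : (univ.filter fun i : Fin ℓ => i.val < ℓ) = univ := by
    ext i; simp
  rw [hf] at h
  exact mul_left_cancel₀ (pow_ne_zero ℓ hN0) (h.trans (mul_one _).symm)

end Neighbours

section Entropy

variable {τ ℓ : ℕ}

/-- The probability that a random vector with law `p` agrees with `y` on `S`. -/
noncomputable def marginalAt (p : (Fin ℓ → Response τ) → ℝ) (S : Finset (Fin ℓ))
    (y : Fin ℓ → Response τ) : ℝ :=
  ∑ y' : Fin ℓ → Response τ with ∀ j ∈ S, y' j = y j, p y'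

/-- The entropy of `Y_S` is the expectation of its surprisal. -/
lemma entropy_eq_neg_sum_log (p : (Fin ℓ → Response τ) → ℝ) (S : Finset (Fin ℓ)) :
    entropy p S = -∑ y, p y * Real.log (marginalAt p S y) := by
  have h : ∀ z : S → Response τ,
      Real.negMulLog (∑ y : Fin ℓ → Response τ with (fun i : S => y i) = z, p y)
        = ∑ y : Fin ℓ → Response τ,
            if (fun i : S => y i) = z then -(p y * Real.log (marginalAt p S y)) else 0 := by
    intro z
    rw [Real.negMulLog, neg_mul, Finset.sum_mul, ← Finset.sum_neg_distrib, Finset.sum_filter]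
    refine Finset.sum_congr rfl fun y _ => ?_
    split_ifs with hz
    · subst hz
      unfold marginalAt
      congr 4
      ext y'
      simp [funext_iff]
    · rfl
  unfold entropy
  simp_rw [h]
  rw [Finset.sum_comm, ← Finset.sum_neg_distrib]
  simp

/-- If, given the other responses, the law of `Y_i` is a function `k` of `Y_c`, then adding `i` to
an index set that contains `c` increases the entropy by an amount that does not depend on the
set. -/
lemma entropy_insert {p f : (Fin ℓ → Response τ) → ℝ} {k : Response τ → Response τ → ℝ}
    {i c : Fin ℓ} (hp0 : ∀ y, 0 ≤ p y) (hp : ∀ y, p y = f y * k (y c) (y i))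
    (hf : ∀ y b, f (Function.update y i b) = f y) (hk : ∀ x, ∑ b, k x b = 1)
    {S : Finset (Fin ℓ)} (hc : c ∈ S) (hi : i ∉ S) :
    entropy p (insert i S) = entropy p S - ∑ y, p y * Real.log (k (y c) (y i)) := by
  set N : ℝ := (Fintype.card (Response τ) : ℝ) with hN
  have hN0 : N ≠ 0 := by rw [hN]; exact_mod_cast Fintype.card_ne_zero
  have hci : c ≠ i := fun h => hi (h ▸ hc)
  have hupd : ∀ (y z : Fin ℓ → Response τ) b,
      (∀ j ∈ S, Function.update y i b j = z j) ↔ ∀ j ∈ S, y j = z j := by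
    intro y z b
    refine forall₂_congr fun j hj => ?_
    rw [Function.update_of_ne (show j ≠ i from fun h => hi (h ▸ hj))]
  -- both marginals are multiples of the sum of `f` over the vectors that agree with `z` on `S`
  have m1 : ∀ z, N * marginalAt p S z
      = ∑ y : Fin ℓ → Response τ, if ∀ j ∈ S, y j = z j then f y else 0 := by
    intro z
    unfold marginalAt
    rw [Finset.sum_filter, ← sum_sum_update i]
    refine Finset.sum_congr rfl fun y _ => ?_
    simp_rw [hupd, hp, hf, Function.update_self, Function.update_of_ne hci]
    split_ifs
    · rw [← Finset.mul_sum, hk, mul_one]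
    · simp
  have m2 : ∀ z, N * marginalAt p (insert i S) z
      = k (z c) (z i) * ∑ y : Fin ℓ → Response τ, if ∀ j ∈ S, y j = z j then f y else 0 := by
    intro z
    unfold marginalAt
    rw [Finset.sum_filter, ← sum_sum_update i, Finset.mul_sum]
    refine Finset.sum_congr rfl fun y _ => ?_
    simp_rw [Finset.forall_mem_insert, hupd, hp, hf, Function.update_self,
      Function.update_of_ne hci]
    by_cases h : ∀ j ∈ S, y j = z j
    · simp only [eq_true h, and_true, if_true, h c hc]
      rw [Finset.sum_ite_eq', if_pos (Finset.mem_univ _), mul_comm]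
    · simp [h]
  have m3 : ∀ z, marginalAt p (insert i S) z = k (z c) (z i) * marginalAt p S z := by
    intro z
    apply mul_left_cancel₀ hN0
    rw [m2, ← m1]; ring
  rw [entropy_eq_neg_sum_log, entropy_eq_neg_sum_log, ← neg_add', ← Finset.sum_add_distrib]
  congr 1
  refine Finset.sum_congr rfl fun y _ => ?_
  by_cases h : p y = 0
  · simp [h]
  · have h1 : k (y c) (y i) ≠ 0 := fun h' => h (by rw [hp, h', mul_zero])
    have h2 : 0 < marginalAt p S y := by
      refine lt_of_lt_of_le (lt_of_le_of_ne (hp0 y) (Ne.symm h)) ?_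
      exact Finset.single_le_sum (f := p) (fun y _ => hp0 y) (by simp)
    rw [m3, Real.log_mul h1 h2.ne']; ring

lemma entropy_nonneg {p : (Fin ℓ → Response τ) → ℝ} (hp0 : ∀ y, 0 ≤ p y) (hp1 : ∑ y, p y = 1)
    (S : Finset (Fin ℓ)) : 0 ≤ entropy p S :=
  Finset.sum_nonneg fun _ _ => Real.negMulLog_nonneg (Finset.sum_nonneg fun y _ => hp0 y)
    (hp1 ▸ Finset.sum_le_sum_of_subset_of_nonneg (Finset.filter_subset _ _)
      fun y _ _ => hp0 y)

lemma card_responses_le (S : Finset (Fin ℓ)) :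
    Fintype.card (S → Response τ) ≤ (τ + 1) ^ ℓ := by
  rw [Fintype.card_fun, Fintype.card_option, Fintype.card_fin, Fintype.card_coe]
  exact Nat.pow_le_pow_right (by omega) (by simpa using Finset.card_le_univ S)

/-- A crude upper bound, which is enough to see that the memory quality is bounded. -/
lemma entropy_le {p : (Fin ℓ → Response τ) → ℝ} (hp0 : ∀ y, 0 ≤ p y)
    (S : Finset (Fin ℓ)) : entropy p S ≤ (τ + 1) ^ ℓ := by
  have h : ∀ x : ℝ, 0 ≤ x → Real.negMulLog x ≤ 1 := by
    intro x hx
    have := Real.negMulLog_le_one_sub_self hx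
    linarith
  calc entropy p S ≤ ∑ _z : S → Response τ, (1 : ℝ) :=
        Finset.sum_le_sum fun _ _ => h _ (Finset.sum_nonneg fun y _ => hp0 y)
    _ = Fintype.card (S → Response τ) := by simp
    _ ≤ _ := by exact_mod_cast card_responses_le S

end Entropy

/-! ### Pools of workers -/

namespace Worker

variable {τ ℓ : ℕ} (w : Worker τ ℓ)

lemma law_nonneg (t : Fin ℓ → Fin τ) (y : Fin ℓ → Response τ) : 0 ≤ w.law t y := by
  unfold law markovLaw
  exact Finset.prod_nonneg fun i _ => w.kernel_nonneg _ _ _ _ _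

lemma sum_law (t : Fin ℓ → Fin τ) : ∑ y, w.law t y = 1 := sum_markovLaw w.kernel_sum t

lemma law_le_one (t : Fin ℓ → Fin τ) (y : Fin ℓ → Response τ) : w.law t y ≤ 1 := by
  rw [← w.sum_law t]
  exact Finset.single_le_sum (fun y _ => w.law_nonneg t y) (Finset.mem_univ y)

end Worker

namespace WorkerPool

variable {τ ℓ : ℕ} (W : WorkerPool τ ℓ)

lemma meanLaw_nonneg (t : Fin ℓ → Fin τ) (y : Fin ℓ → Response τ) : 0 ≤ W.meanLaw t y := by
  obtain ⟨v, hv⟩ := W.exists_mean_worker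
  exact (v.law_nonneg t y).trans_eq (hv t y).symm

lemma sum_meanLaw (t : Fin ℓ → Fin τ) : ∑ y, W.meanLaw t y = 1 := by
  obtain ⟨v, hv⟩ := W.exists_mean_worker
  exact (Finset.sum_congr rfl fun y _ => hv t y).trans (v.sum_law t)

lemma integrable_law (t : Fin ℓ → Fin τ) (y : Fin ℓ → Response τ) :
    letI := W.measurableSpace
    MeasureTheory.Integrable (fun w => (W.worker w).law t y) W.dist := by
  let _ := W.measurableSpace
  have := W.isProbabilityMeasure
  refine MeasureTheory.Integrable.of_bound (C := 1) ?_ (Filter.Eventually.of_forall fun w => ?_)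
  · refine Measurable.aestronglyMeasurable ?_
    unfold Worker.law markovLaw
    exact Finset.measurable_prod _ fun i _ => W.measurable_kernel _ _ _ _ _
  · rw [Real.norm_of_nonneg ((W.worker w).law_nonneg t y)]
    exact (W.worker w).law_le_one t y

lemma sum_meanLaw_filter (t : Fin ℓ → Fin τ) (i : Fin ℓ) (a : Response τ) :
    ∑ y : Fin ℓ → Response τ with y i = a, W.meanLaw t y = W.meanMarginal (t i) a := by
  let _ := W.measurableSpace
  unfold meanLaw meanMarginal
  rw [← MeasureTheory.integral_finsetSum _ fun y _ => W.integrable_law t y]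
  exact MeasureTheory.integral_congr_ae
    (Filter.Eventually.of_forall fun w => (W.worker w).marginal_eq t i a)

lemma meanMarginal_nonneg [NeZero ℓ] (c : Fin τ) (a : Response τ) : 0 ≤ W.meanMarginal c a := by
  rw [← W.sum_meanLaw_filter (fun _ => c) 0 a]
  exact Finset.sum_nonneg fun y _ => W.meanLaw_nonneg _ y

lemma sum_meanMarginal [NeZero ℓ] (c : Fin τ) : ∑ a, W.meanMarginal c a = 1 := by
  rw [← W.sum_meanLaw (fun _ => c)]
  simp_rw [← W.sum_meanLaw_filter (fun _ => c) 0]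
  exact Finset.sum_fiberwise _ _ _

lemma meanMarginal_le_one [NeZero ℓ] (c : Fin τ) (a : Response τ) : W.meanMarginal c a ≤ 1 := by
  rw [← W.sum_meanMarginal c]
  exact Finset.single_le_sum (fun a _ => W.meanMarginal_nonneg c a) (Finset.mem_univ a)

lemma le_tvDist_of_le_distanceQuality {θ : ℝ} (hW : (θ : EReal) ≤ W.distanceQuality)
    {c d : Fin τ} (hcd : c ≠ d) : θ ≤ tvDist (W.meanMarginal c) (W.meanMarginal d) := by
  have h := hW.trans ((iInf_le _ c).trans ((iInf_le _ d).trans (iInf_le _ hcd)))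
  exact_mod_cast h

lemma tvDist_meanMarginal_le_two [NeZero ℓ] (c d : Fin τ) :
    tvDist (W.meanMarginal c) (W.meanMarginal d) ≤ 2 := by
  unfold tvDist
  calc _ ≤ ∑ a, (W.meanMarginal c a + W.meanMarginal d a) := by
        refine Finset.sum_le_sum fun a _ => (abs_sub _ _).trans_eq ?_
        rw [abs_of_nonneg (W.meanMarginal_nonneg c a), abs_of_nonneg (W.meanMarginal_nonneg d a)]
    _ = 2 := by rw [Finset.sum_add_distrib, W.sum_meanMarginal, W.sum_meanMarginal]; norm_num

end WorkerPool

/-- The last position. -/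
def lastPos {ℓ : ℕ} (h : 2 ≤ ℓ) : Fin ℓ := ⟨ℓ - 1, by omega⟩

/-- The last position but one. -/
def penultPos {ℓ : ℕ} (h : 2 ≤ ℓ) : Fin ℓ := ⟨ℓ - 2, by omega⟩

/-- The information that the last but one and the `j`-th response give on the last response. -/
noncomputable def lastInfo {τ ℓ : ℕ} (h : 2 ≤ ℓ) (p : (Fin ℓ → Response τ) → ℝ) (j : Fin ℓ) : ℝ :=
  mutualInfo p {lastPos h} ({penultPos h} ∪ {j})

section LastPosition

variable {τ ℓ : ℕ} (hℓ : 2 ≤ ℓ)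

lemma penultPos_lt_lastPos : penultPos hℓ < lastPos hℓ := by
  simp only [penultPos, lastPos, Fin.lt_def]; omega

lemma lt_lastPos_iff {j : Fin ℓ} : j < lastPos hℓ ↔ j < penultPos hℓ ∨ j = penultPos hℓ := by
  simp only [penultPos, lastPos, Fin.lt_def, Fin.ext_iff]; omega

lemma prevIdx_lastPos : prevIdx (lastPos hℓ) = some (penultPos hℓ) := by
  unfold prevIdx lastPos penultPos
  rw [if_pos (by simp only; omega)]
  simp only [Option.some_inj, Fin.mk.injEq]
  omega

/-- If the last position has one neighbour only, then all earlier positions give the same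
information on the last response, by the Markov property. -/
lemma WorkerPool.lastInfo_eq (W : WorkerPool τ ℓ) (t : Fin ℓ → Fin τ)
    (ht : ∀ j, lastSame t (lastPos hℓ) = some j → j = penultPos hℓ) {j j' : Fin ℓ}
    (hj : j < penultPos hℓ) (hj' : j' < penultPos hℓ) :
    lastInfo hℓ (W.meanLaw t) j = lastInfo hℓ (W.meanLaw t) j' := by
  obtain ⟨v, hv⟩ := W.exists_mean_worker
  set i := lastPos hℓ with hi
  set c := penultPos hℓ with hc
  have hci : c < i := penultPos_lt_lastPos hℓ
  -- the kernel at the last position sees the last but one response only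
  obtain ⟨k, hk1, hk⟩ : ∃ k : Response τ → Response τ → ℝ, (∀ x, ∑ b, k x b = 1) ∧
      ∀ y : Fin ℓ → Response τ, v.kernel i ((prevIdx i).map y) ((lastSame t i).map y) (t i) (y i)
        = k (y c) (y i) := by
    rw [hi, prevIdx_lastPos, ← hi, ← hc]
    rcases hs : lastSame t i with _ | j₀
    · exact ⟨fun x b => v.kernel i (some x) none (t i) b, fun x => v.kernel_sum _ _ _ _,
        fun y => rfl⟩
    · obtain rfl := ht j₀ hs
      exact ⟨fun x b => v.kernel i (some x) (some x) (t i) b, fun x => v.kernel_sum _ _ _ _,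
        fun y => rfl⟩
  set f : (Fin ℓ → Response τ) → ℝ := fun y => ∏ m ∈ univ.erase i,
    v.kernel m ((prevIdx m).map y) ((lastSame t m).map y) (t m) (y m) with hf
  have hp : ∀ y, W.meanLaw t y = f y * k (y c) (y i) := by
    intro y
    rw [← hk y]
    refine (hv t y).trans ?_
    exact (Finset.prod_erase_mul univ _ (Finset.mem_univ i)).symm
  have hfu : ∀ y b, f (Function.update y i b) = f y := by
    intro y b
    refine Finset.prod_congr rfl fun m hm => markov_factor_update v.kernel t ?_ y b
    have : m ≠ i := (Finset.mem_erase.mp hm).1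
    simp only [hi, lastPos, Fin.lt_def, ne_eq, Fin.ext_iff] at this ⊢
    omega
  have key : ∀ j < c, lastInfo hℓ (W.meanLaw t) j
      = entropy (W.meanLaw t) {i} + ∑ y, W.meanLaw t y * Real.log (k (y c) (y i)) := by
    intro j hj
    unfold lastInfo mutualInfo
    rw [← hi, ← hc, Finset.singleton_union i,
      entropy_insert (W.meanLaw_nonneg t) hp hfu hk1 (c := c) (by simp)]
    · ring
    · simp [hci.ne', (hj.trans hci).ne']
  rw [key j hj, key j' hj']

/-- If the last position has two neighbours, then the information on the last response
distinguishes the second one by the memory quality. -/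
lemma WorkerPool.lastInfo_gap (W : WorkerPool τ ℓ) {θ : ℝ} (hW : (θ : EReal) ≤ W.memoryQuality)
    (t : Fin ℓ → Fin τ) {j j' : Fin ℓ} (hs : lastSame t (lastPos hℓ) = some j)
    (hj : j ≠ penultPos hℓ) (hj' : j' < penultPos hℓ) (hne : j' ≠ j) :
    lastInfo hℓ (W.meanLaw t) j' + 2 * θ ≤ lastInfo hℓ (W.meanLaw t) j := by
  have hN : neighbours t (lastPos hℓ) = {penultPos hℓ} ∪ {j} := by
    unfold neighbours
    rw [prevIdx_lastPos, hs]
    rfl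
  have hcard : (neighbours t (lastPos hℓ)).card = 2 := by
    rw [hN, Finset.singleton_union, Finset.card_pair (Ne.symm hj)]
  have hlt : j' < lastPos hℓ := hj'.trans (penultPos_lt_lastPos hℓ)
  have hnot : j' ∉ neighbours t (lastPos hℓ) := by
    rw [hN]; simp [hj'.ne, hne]
  have h := hW.trans ((iInf_le _ t).trans ((iInf_le _ (lastPos hℓ)).trans
    ((iInf_le _ hcard).trans ((iInf_le _ (lastPos hℓ)).trans ((iInf_le _ hcard).trans
    ((iInf_le _ j').trans ((iInf_le _ hlt).trans (iInf_le _ hnot))))))))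
  have h' := EReal.coe_le_coe_iff.mp h
  rw [hN, prevIdx_lastPos] at h'
  have e : (some (penultPos hℓ)).toFinset = {penultPos hℓ} := rfl
  rw [e] at h'
  unfold lastInfo
  linarith

lemma abs_lastInfo_sub_le {p q : (Fin ℓ → Response τ) → ℝ} {η : ℝ}
    (h : ∀ S, |entropy p S - entropy q S| < η) (j : Fin ℓ) :
    |lastInfo hℓ p j - lastInfo hℓ q j| < 3 * η := by
  unfold lastInfo mutualInfo
  have h1 := abs_lt.mp (h {lastPos hℓ})
  have h2 := abs_lt.mp (h ({penultPos hℓ} ∪ {j}))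
  have h3 := abs_lt.mp (h ({lastPos hℓ} ∪ ({penultPos hℓ} ∪ {j})))
  rw [abs_lt]
  constructor <;> linarith

end LastPosition

/-! ### Error probabilities of schemes -/

section Schemes

variable {τ ℓ : ℕ}

lemma sampleComplexity_le {ε θd θm : ℝ} {n : ℕ} (Φ : Scheme τ ℓ n)
    (hΦ : ∀ W : WorkerPool τ ℓ, (θd : EReal) ≤ W.distanceQuality →
      (θm : EReal) ≤ W.memoryQuality → ∀ P ∈ stdSimplex ℝ (Fin τ), Φ.errorProb W P < ε) :
    (sampleComplexity τ ℓ ε θd θm : ENNReal) ≤ n := by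
  have h : sampleComplexity τ ℓ ε θd θm ≤ n := iInf₂_le n ⟨Φ, hΦ⟩
  exact (ENat.toENNReal_mono h).trans_eq (ENat.toENNReal_coe n)

/-- The law of the responses of the `j`-th worker of a scheme. -/
noncomputable def Scheme.workerLaw {n : ℕ} (Φ : Scheme τ ℓ n) (W : WorkerPool τ ℓ)
    (t : Fin ℓ → Fin τ) (j : Fin n) : (Fin ℓ → Response τ) → ℝ :=
  W.meanLaw (t ∘ Φ.order j)

/-- The error probability is an average over the labels. -/
lemma Scheme.errorProb_le {n : ℕ} (Φ : Scheme τ ℓ n) (W : WorkerPool τ ℓ) {P : Fin τ → ℝ}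
    (hP : P ∈ stdSimplex ℝ (Fin τ)) {δ : ℝ}
    (h : ∀ t, prodProb (Φ.workerLaw W t) (fun Y => Φ.decode Y ≠ Setoid.ker t) ≤ δ) :
    Φ.errorProb W P ≤ δ := by
  have h1 : ∑ t : Fin ℓ → Fin τ, ∏ i, P (t i) = 1 := by
    rw [sum_prod_pi (fun _ => P)]; simp [hP.2]
  calc Φ.errorProb W P
      = ∑ t : Fin ℓ → Fin τ, (∏ i, P (t i)) *
          prodProb (Φ.workerLaw W t) (fun Y => Φ.decode Y ≠ Setoid.ker t) := by
        unfold Scheme.errorProb prodProb Scheme.workerLaw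
        congr!
    _ ≤ ∑ t : Fin ℓ → Fin τ, (∏ i, P (t i)) * δ := Finset.sum_le_sum fun t _ =>
        mul_le_mul_of_nonneg_left (h t) (Finset.prod_nonneg fun i _ => hP.1 _)
    _ = δ := by rw [← Finset.sum_mul, h1, one_mul]

lemma eqvGen_setoid_eq {A : Type*} {r : A → A → Prop} {s : Setoid A}
    (h : ∀ a b, r a b ↔ s a b) : Relation.EqvGen.setoid r = s := by
  have : r = ⇑s := by funext a b; exact propext (h a b)
  rw [this]
  exact Setoid.eqvGen_of_setoid s

lemma card_response : Fintype.card (Response τ) = τ + 1 := by simp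

/-! ### Clustering by distance -/

/-- The empirical law of the responses to the object `a`, when all workers use the same order. -/
noncomputable def empMarginal {n : ℕ} (Y : Fin n → Fin ℓ → Response τ) (a : Fin ℓ)
    (y : Response τ) : ℝ :=
  (n : ℝ)⁻¹ * ∑ j, if Y j a = y then 1 else 0

/-- All workers use the same order, and objects with close empirical response laws are put
together. -/
noncomputable def distanceScheme (τ ℓ n : ℕ) (θ : ℝ) : Scheme τ ℓ n where
  order _ := Equiv.refl _
  decode Y := Relation.EqvGen.setoid fun a b => tvDist (empMarginal Y a) (empMarginal Y b) < θ / 2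

lemma tvDist_triangle {A : Type} [Fintype A] (p q r : A → ℝ) :
    tvDist p r ≤ tvDist p q + tvDist q r := by
  unfold tvDist
  rw [← Finset.sum_add_distrib]
  exact Finset.sum_le_sum fun a _ => abs_sub_le _ _ _

lemma tvDist_comm {A : Type} [Fintype A] (p q : A → ℝ) : tvDist p q = tvDist q p := by
  unfold tvDist
  exact Finset.sum_congr rfl fun a _ => abs_sub_comm _ _

lemma decode_distanceScheme {n : ℕ} {θ : ℝ} {W : WorkerPool τ ℓ}
    (hW : (θ : EReal) ≤ W.distanceQuality) (t : Fin ℓ → Fin τ) (Y : Fin n → Fin ℓ → Response τ)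
    (hY : ∀ (a : Fin ℓ) (y : Response τ),
      |empMarginal Y a y - W.meanMarginal (t a) y| < θ / (4 * (τ + 1))) :
    (distanceScheme τ ℓ n θ).decode Y = Setoid.ker t := by
  have h1 : ∀ a, tvDist (empMarginal Y a) (W.meanMarginal (t a)) < θ / 4 := by
    intro a
    calc _ < ∑ _y : Response τ, θ / (4 * (τ + 1)) :=
          Finset.sum_lt_sum_of_nonempty Finset.univ_nonempty fun y _ => hY a y
      _ = θ / 4 := by
          rw [Finset.sum_const, Finset.card_univ, card_response, nsmul_eq_mul]
          push_cast
          field_simp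
  refine eqvGen_setoid_eq fun a b => ?_
  rw [Setoid.ker_def]
  have ha := h1 a
  have hb := h1 b
  constructor
  · intro hab
    by_contra hne
    have h2 := W.le_tvDist_of_le_distanceQuality hW hne
    have h3 := tvDist_triangle (W.meanMarginal (t a)) (empMarginal Y a) (W.meanMarginal (t b))
    have h4 := tvDist_triangle (empMarginal Y a) (empMarginal Y b) (W.meanMarginal (t b))
    rw [tvDist_comm (W.meanMarginal (t a)) (empMarginal Y a)] at h3
    linarith
  · intro hab
    have h3 := tvDist_triangle (empMarginal Y a) (W.meanMarginal (t a)) (empMarginal Y b)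
    rw [tvDist_comm (W.meanMarginal (t a)) (empMarginal Y b), hab] at h3
    rw [hab] at ha
    linarith

lemma prodProb_distanceScheme_le [NeZero ℓ] {n : ℕ} (hn : 0 < n) {θ : ℝ} (hθ : 0 < θ)
    {W : WorkerPool τ ℓ} (hW : (θ : EReal) ≤ W.distanceQuality) (t : Fin ℓ → Fin τ) :
    prodProb ((distanceScheme τ ℓ n θ).workerLaw W t)
        (fun Y => (distanceScheme τ ℓ n θ).decode Y ≠ Setoid.ker t)
      ≤ ℓ * (τ + 1) * (2 * Real.exp (-(n * (θ / (4 * (τ + 1))) ^ 2 / 2))) := by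
  have hlaw : ∀ j, (distanceScheme τ ℓ n θ).workerLaw W t j = W.meanLaw t := fun j => rfl
  set p := (distanceScheme τ ℓ n θ).workerLaw W t
  set η : ℝ := θ / (4 * (τ + 1)) with hη
  have hη0 : 0 < η := by positivity
  have hn0 : (0 : ℝ) < n := by exact_mod_cast hn
  have hp : ∀ j a, 0 ≤ p j a := fun j a => by rw [hlaw]; exact W.meanLaw_nonneg t a
  have hp1 : ∀ j, ∑ a, p j a = 1 := fun j => by rw [hlaw]; exact W.sum_meanLaw t
  have hone : ∀ (a : Fin ℓ) (y : Response τ),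
      prodProb p (fun Y => η ≤ |empMarginal Y a y - W.meanMarginal (t a) y|)
        ≤ 2 * Real.exp (-(n * η ^ 2 / 2)) := by
    intro a y
    set Q := W.meanMarginal (t a) y with hQ
    have hQ0 : 0 ≤ Q := W.meanMarginal_nonneg _ _
    have hQ1 : Q ≤ 1 := W.meanMarginal_le_one _ _
    have h := prodProb_abs_sum_ge_le hp hp1
      (h := fun _ z => (if z a = y then 1 else 0) - Q) ?_ ?_ η hη0.le
    · rw [Fintype.card_fin] at h
      refine (prodProb_mono hp fun Y _ hY => ?_).trans h
      have e : ∑ j, ((if Y j a = y then 1 else 0) - Q) = n * (empMarginal Y a y - Q) := by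
        rw [Finset.sum_sub_distrib, empMarginal, mul_sub, mul_inv_cancel_left₀ hn0.ne']
        simp
      rw [e, abs_mul, abs_of_pos hn0]
      exact mul_le_mul_of_nonneg_left hY hn0.le
    · intro _ z
      rw [abs_le]
      split_ifs <;> constructor <;> linarith
    · intro j
      rw [hlaw]
      simp only [mul_sub, mul_ite, mul_one, mul_zero, Finset.sum_sub_distrib]
      rw [← Finset.sum_filter, W.sum_meanLaw_filter t a y, ← Finset.sum_mul, W.sum_meanLaw]
      ring
  have hu := prodProb_exists_le hp
    (fun (k : Fin ℓ × Response τ) Y => η ≤ |empMarginal Y k.1 k.2 - W.meanMarginal (t k.1) k.2|)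
  refine (prodProb_mono hp fun Y _ hY => ?_).trans (hu.trans ?_)
  · by_contra hcon
    push Not at hcon
    exact hY (decode_distanceScheme hW t Y fun a y => hcon (a, y))
  · calc _ ≤ ∑ _k : Fin ℓ × Response τ, 2 * Real.exp (-(n * η ^ 2 / 2)) :=
          Finset.sum_le_sum fun k _ => hone k.1 k.2
      _ = _ := by
          rw [Finset.sum_const, Finset.card_univ, Fintype.card_prod, card_response,
            Fintype.card_fin, nsmul_eq_mul]
          push_cast
          ring

lemma sampleComplexity_le_of_distance [NeZero ℓ] {ε θd : ℝ} (θm : ℝ) (hθ : 0 < θd) {n : ℕ}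
    (hn : 0 < n)
    (h : ℓ * (τ + 1) * (2 * Real.exp (-(n * (θd / (4 * (τ + 1))) ^ 2 / 2))) < ε) :
    (sampleComplexity τ ℓ ε θd θm : ENNReal) ≤ n :=
  sampleComplexity_le (distanceScheme τ ℓ n θd) fun W hW _ _ hP =>
    (Scheme.errorProb_le _ W hP fun t => prodProb_distanceScheme_le hn hθ hW t).trans_lt h

/-! ### Clustering by memory -/

/-- Given estimates `I σ j` of the information `lastInfo` for the order `σ`, the position `j` is
detected if it gives distinctly more information than all other positions. -/
def Detects (hℓ : 2 ≤ ℓ) (θ : ℝ) (I : Equiv.Perm (Fin ℓ) → Fin ℓ → ℝ) (σ : Equiv.Perm (Fin ℓ))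
    (j : Fin ℓ) : Prop :=
  j < penultPos hℓ ∧ ∀ j' < penultPos hℓ, j' ≠ j → I σ j' + θ < I σ j

open Classical in
/-- Two objects are put together if, in some order, one is last and the other one is detected;
if nothing is ever detected, all objects are put together. -/
noncomputable def memoryDecode (hℓ : 2 ≤ ℓ) (θ : ℝ) (I : Equiv.Perm (Fin ℓ) → Fin ℓ → ℝ) :
    Setoid (Fin ℓ) :=
  if ∃ σ j, Detects hℓ θ I σ j then
    Relation.EqvGen.setoid fun a b =>
      a = b ∨ ∃ σ j, Detects hℓ θ I σ j ∧ σ j = a ∧ σ (lastPos hℓ) = b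
  else ⊤

lemma exists_perm_apply_eq₃ {A : Type*} [DecidableEq A] {x y z a b c : A} (hxy : x ≠ y)
    (hxz : x ≠ z) (hyz : y ≠ z) (hab : a ≠ b) (hac : a ≠ c) (hbc : b ≠ c) :
    ∃ σ : Equiv.Perm A, σ x = a ∧ σ y = b ∧ σ z = c := by
  set σ₁ := Equiv.swap x a with h₁
  have e1 : σ₁ x = a := Equiv.swap_apply_left x a
  set σ₂ := σ₁.trans (Equiv.swap (σ₁ y) b) with h₂
  have e2 : σ₂ x = a := by
    rw [h₂, Equiv.trans_apply, e1]
    exact Equiv.swap_apply_of_ne_of_ne (fun h => hxy (σ₁.injective (e1.trans h))) hab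
  have e3 : σ₂ y = b := by simp [h₂]
  refine ⟨σ₂.trans (Equiv.swap (σ₂ z) c), ?_, ?_, by simp⟩
  · rw [Equiv.trans_apply, e2]
    exact Equiv.swap_apply_of_ne_of_ne (fun h => hxz (σ₂.injective (e2.trans h))) hac
  · rw [Equiv.trans_apply, e3]
    exact Equiv.swap_apply_of_ne_of_ne (fun h => hyz (σ₂.injective (e3.trans h))) hbc

variable {θ : ℝ} {W : WorkerPool τ ℓ} {t : Fin ℓ → Fin τ}
  {I : Equiv.Perm (Fin ℓ) → Fin ℓ → ℝ}

/-- With accurate estimates, a position is detected if and only if it is the second neighbour of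
the last position. At least four positions are needed, so that a candidate has a rival. -/
lemma detects_iff (hℓ : 2 ≤ ℓ) (h4 : 4 ≤ ℓ) (hW : (θ : EReal) ≤ W.memoryQuality)
    (hI : ∀ σ j, |I σ j - lastInfo hℓ (W.meanLaw (t ∘ σ)) j| < θ / 2)
    (σ : Equiv.Perm (Fin ℓ)) (j : Fin ℓ) :
    Detects hℓ θ I σ j ↔ lastSame (t ∘ σ) (lastPos hℓ) = some j ∧ j ≠ penultPos hℓ := by
  constructor
  · rintro ⟨hj, hdet⟩
    refine ⟨?_, hj.ne⟩
    by_cases hN : ∀ j₀, lastSame (t ∘ σ) (lastPos hℓ) = some j₀ → j₀ = penultPos hℓ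
    · exfalso
      obtain ⟨j', hj', hne⟩ : ∃ j' < penultPos hℓ, j' ≠ j := by
        by_cases h0 : j.val = 0
        · refine ⟨⟨1, by omega⟩, ?_, ?_⟩ <;> simp [penultPos, Fin.lt_def, Fin.ext_iff] <;> omega
        · refine ⟨⟨0, by omega⟩, ?_, ?_⟩ <;> simp [penultPos, Fin.lt_def, Fin.ext_iff] <;> omega
      have h1 := hdet j' hj' hne
      have h2 := W.lastInfo_eq hℓ (t ∘ σ) hN hj hj'
      have h3 := abs_lt.mp (hI σ j)
      have h4 := abs_lt.mp (hI σ j')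
      linarith
    · push Not at hN
      obtain ⟨j₀, hs, hj₀⟩ := hN
      rw [hs]
      by_contra hne
      have hne' : j ≠ j₀ := fun h => hne (by rw [h])
      have hlt : j₀ < penultPos hℓ :=
        ((lt_lastPos_iff hℓ).mp (lt_of_lastSame_eq_some hs)).resolve_right hj₀
      have h1 := hdet j₀ hlt hne'.symm
      have h2 := W.lastInfo_gap hℓ hW (t ∘ σ) hs hj₀ hj hne'
      have h3 := abs_lt.mp (hI σ j)
      have h4 := abs_lt.mp (hI σ j₀)
      linarith
  · rintro ⟨hs, hj⟩
    refine ⟨((lt_lastPos_iff hℓ).mp (lt_of_lastSame_eq_some hs)).resolve_right hj,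
      fun j' hj' hne => ?_⟩
    have h2 := W.lastInfo_gap hℓ hW (t ∘ σ) hs hj hj' hne
    have h3 := abs_lt.mp (hI σ j)
    have h4 := abs_lt.mp (hI σ j')
    linarith

/-- If two objects of one class and an object of another class are put at the end of the order,
with the odd one in between, then the first of them is detected. -/
lemma exists_detects (hℓ : 2 ≤ ℓ) (h4 : 4 ≤ ℓ) (hW : (θ : EReal) ≤ W.memoryQuality)
    (hI : ∀ σ j, |I σ j - lastInfo hℓ (W.meanLaw (t ∘ σ)) j| < θ / 2)
    {a b c : Fin ℓ} (hab : a ≠ b) (ht : t a = t b) (hc : t c ≠ t b) :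
    ∃ σ j, Detects hℓ θ I σ j ∧ σ j = a ∧ σ (lastPos hℓ) = b := by
  let x : Fin ℓ := ⟨ℓ - 3, by omega⟩
  have hx : x < penultPos hℓ := by simp only [x, penultPos, Fin.lt_def]; omega
  have hpl := penultPos_lt_lastPos hℓ
  obtain ⟨σ, h1, h2, h3⟩ := exists_perm_apply_eq₃ hx.ne (hx.trans hpl).ne hpl.ne
    (a := a) (b := c) (c := b) (fun h => hc (by rw [← h, ht])) hab (fun h => hc (by rw [h]))
  refine ⟨σ, x, ?_, h1, h3⟩
  rw [detects_iff hℓ h4 hW hI]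
  refine ⟨lastSame_eq_some_iff.mpr ⟨hx.trans hpl, by simp [h1, h3, ht], fun k hk hk' => ?_⟩, hx.ne⟩
  have hkc : k ≠ penultPos hℓ := by
    rintro rfl
    simp only [Function.comp_apply, h2, h3] at hk'
    exact hc hk'
  have := ((lt_lastPos_iff hℓ).mp hk).resolve_right hkc
  simp only [x, penultPos, Fin.lt_def, Fin.le_def] at this ⊢
  omega

lemma memoryDecode_eq (hℓ : 2 ≤ ℓ) (h4 : 4 ≤ ℓ) (hτ : τ < ℓ) (hW : (θ : EReal) ≤ W.memoryQuality)
    (hI : ∀ σ j, |I σ j - lastInfo hℓ (W.meanLaw (t ∘ σ)) j| < θ / 2) :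
    memoryDecode hℓ θ I = Setoid.ker t := by
  unfold memoryDecode
  split_ifs with h
  · refine eqvGen_setoid_eq fun a b => ?_
    rw [Setoid.ker_def]
    constructor
    · rintro (rfl | ⟨σ, j, hd, rfl, rfl⟩)
      · rfl
      · exact (lastSame_eq_some_iff.mp ((detects_iff hℓ h4 hW hI σ j).mp hd).1).2.1
    · intro hab
      by_cases hne : a = b
      · exact Or.inl hne
      · right
        -- a detection shows that there are two classes at least
        obtain ⟨σ, j, hd⟩ := h
        obtain ⟨hs, hj⟩ := (detects_iff hℓ h4 hW hI σ j).mp hd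
        have hdiff : t (σ (penultPos hℓ)) ≠ t (σ (lastPos hℓ)) := by
          intro heq
          have := (lastSame_eq_some_iff.mp hs).2.2 _ (penultPos_lt_lastPos hℓ) heq
          exact absurd (((lt_lastPos_iff hℓ).mp (lt_of_lastSame_eq_some hs)).resolve_right hj)
            (not_lt.mpr this)
        obtain ⟨c, hc⟩ : ∃ c, t c ≠ t b := by
          by_contra hcon
          push Not at hcon
          exact hdiff ((hcon _).trans (hcon _).symm)
        exact exists_detects hℓ h4 hW hI hne hab hc
  · -- two objects share a class, and would be detected if there were a second class
    obtain ⟨a, b, hne, hab⟩ := Fintype.exists_ne_map_eq_of_card_lt t (by simpa using hτ)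
    have hall : ∀ c, t c = t b := by
      intro c
      by_contra hc
      obtain ⟨σ, j, hd, -⟩ := exists_detects hℓ h4 hW hI hne hab hc
      exact h ⟨σ, j, hd⟩
    ext x y
    rw [Setoid.ker_def, hall x, hall y]
    simp

/-- The empirical law of the response vectors of the workers in `s`. -/
noncomputable def empLaw {n : ℕ} (s : Finset (Fin n)) (Y : Fin n → Fin ℓ → Response τ)
    (y : Fin ℓ → Response τ) : ℝ :=
  (s.card : ℝ)⁻¹ * ∑ j ∈ s, if Y j = y then 1 else 0

lemma entropy_empLaw {n : ℕ} (s : Finset (Fin n)) (Y : Fin n → Fin ℓ → Response τ)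
    (S : Finset (Fin ℓ)) :
    entropy (empLaw s Y) S = ∑ z : S → Response τ, Real.negMulLog
      ((s.card : ℝ)⁻¹ * ∑ j ∈ s, if (fun i : S => Y j i) = z then 1 else 0) := by
  unfold entropy empLaw
  refine Finset.sum_congr rfl fun z _ => ?_
  rw [← Finset.mul_sum, Finset.sum_comm]
  congr 2
  refine Finset.sum_congr rfl fun j _ => ?_
  rw [Finset.sum_ite_eq]
  simp

/-- An enumeration of the workers, `m` for every order. -/
noncomputable def memoryWorkers (ℓ m : ℕ) :
    Fin (Fintype.card (Equiv.Perm (Fin ℓ) × Fin m)) ≃ Equiv.Perm (Fin ℓ) × Fin m :=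
  (Fintype.equivFin _).symm

/-- The workers that use the order `σ`. -/
noncomputable def workersOf (m : ℕ) (σ : Equiv.Perm (Fin ℓ)) :
    Finset (Fin (Fintype.card (Equiv.Perm (Fin ℓ) × Fin m))) :=
  Finset.univ.filter fun j => (memoryWorkers ℓ m j).1 = σ

lemma card_workersOf (m : ℕ) (σ : Equiv.Perm (Fin ℓ)) : (workersOf m σ).card = m := by
  have h : workersOf m σ
      = (Finset.univ : Finset (Fin m)).image fun k => (memoryWorkers ℓ m).symm (σ, k) := by
    ext j
    simp only [workersOf, mem_filter, mem_univ, true_and, mem_image]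
    constructor
    · rintro rfl
      exact ⟨(memoryWorkers ℓ m j).2, by simp⟩
    · rintro ⟨k, rfl⟩
      simp
  rw [h, Finset.card_image_of_injective _ fun a b hab => by simpa using hab, Finset.card_univ,
    Fintype.card_fin]

/-- Every order is used by `m` workers, and the classes are found from the plug-in estimates of
the information that pairs of responses give on the last response. -/
noncomputable def memoryScheme (τ : ℕ) (hℓ : 2 ≤ ℓ) (m : ℕ) (θ : ℝ) :
    Scheme τ ℓ (Fintype.card (Equiv.Perm (Fin ℓ) × Fin m)) where
  order j := (memoryWorkers ℓ m j).1
  decode Y := memoryDecode hℓ θ fun σ j => lastInfo hℓ (empLaw (workersOf m σ) Y) j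

lemma prodProb_memoryScheme_le (hℓ : 2 ≤ ℓ) (h4 : 4 ≤ ℓ) (hτ : τ < ℓ) {m : ℕ} (hm : 0 < m)
    (hθ : 0 < θ) (hW : (θ : EReal) ≤ W.memoryQuality) (t : Fin ℓ → Fin τ) :
    prodProb ((memoryScheme τ hℓ m θ).workerLaw W t)
        (fun Y => (memoryScheme τ hℓ m θ).decode Y ≠ Setoid.ker t)
      ≤ Fintype.card (Equiv.Perm (Fin ℓ) × Finset (Fin ℓ)) *
          ((τ + 1) ^ ℓ * (16 / (θ / 6) ^ 2 + 2 / (θ / 6)) / m) := by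
  have hlaw : ∀ σ, ∀ j ∈ workersOf m σ,
      (memoryScheme τ hℓ m θ).workerLaw W t j = W.meanLaw (t ∘ σ) := by
    intro σ j hj
    rw [workersOf, mem_filter] at hj
    rw [← hj.2]
    rfl
  set p := (memoryScheme τ hℓ m θ).workerLaw W t
  have hp : ∀ j a, 0 ≤ p j a := fun j a => W.meanLaw_nonneg _ a
  have hp1 : ∀ j, ∑ a, p j a = 1 := fun j => W.sum_meanLaw _
  have hone : ∀ (σ : Equiv.Perm (Fin ℓ)) (S : Finset (Fin ℓ)),
      prodProb p (fun Y => θ / 6 ≤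
        |entropy (empLaw (workersOf m σ) Y) S - entropy (W.meanLaw (t ∘ σ)) S|)
        ≤ (τ + 1) ^ ℓ * (16 / (θ / 6) ^ 2 + 2 / (θ / 6)) / m := by
    intro σ S
    have h := prodProb_entropy_ge_le hp hp1 (s := workersOf m σ)
      (Finset.card_pos.mp (by rw [card_workersOf]; exact hm)) (hlaw σ)
      (fun y => (fun i : S => y i)) (show 0 < θ / 6 by positivity)
    rw [card_workersOf] at h
    simp_rw [entropy_empLaw, card_workersOf]
    refine h.trans ?_
    gcongr
    exact_mod_cast card_responses_le S
  have hu := prodProb_exists_le hp (fun (k : Equiv.Perm (Fin ℓ) × Finset (Fin ℓ)) Y => θ / 6 ≤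
    |entropy (empLaw (workersOf m k.1) Y) k.2 - entropy (W.meanLaw (t ∘ k.1)) k.2|)
  refine (prodProb_mono hp fun Y _ hY => ?_).trans (hu.trans ?_)
  · by_contra hcon
    push Not at hcon
    have hest : ∀ σ j, |lastInfo hℓ (empLaw (workersOf m σ) Y) j
        - lastInfo hℓ (W.meanLaw (t ∘ σ)) j| < θ / 2 := by
      intro σ j
      have hS : ∀ S, |entropy (empLaw (workersOf m σ) Y) S - entropy (W.meanLaw (t ∘ σ)) S|
          < θ / 6 := fun S => hcon (σ, S)
      exact (abs_lastInfo_sub_le hℓ hS j).trans_eq (by ring)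
    exact hY (memoryDecode_eq (I := fun σ j => lastInfo hℓ (empLaw (workersOf m σ) Y) j)
      hℓ h4 hτ hW hest)
  · calc _ ≤ ∑ _k : Equiv.Perm (Fin ℓ) × Finset (Fin ℓ),
            ((τ + 1 : ℝ) ^ ℓ * (16 / (θ / 6) ^ 2 + 2 / (θ / 6)) / m) :=
          Finset.sum_le_sum fun k _ => hone k.1 k.2
      _ = _ := by rw [Finset.sum_const, Finset.card_univ, nsmul_eq_mul]

lemma sampleComplexity_le_of_memory {ε θm : ℝ} (θd : ℝ) (hℓ : 2 ≤ ℓ) (h4 : 4 ≤ ℓ) (hτ : τ < ℓ)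
    (hθ : 0 < θm) {m : ℕ} (hm : 0 < m)
    (h : Fintype.card (Equiv.Perm (Fin ℓ) × Finset (Fin ℓ)) *
      ((τ + 1) ^ ℓ * (16 / (θm / 6) ^ 2 + 2 / (θm / 6)) / m) < ε) :
    (sampleComplexity τ ℓ ε θd θm : ENNReal) ≤
      (Fintype.card (Equiv.Perm (Fin ℓ) × Fin m) : ℕ) :=
  sampleComplexity_le (memoryScheme τ hℓ m θm) fun W _ hW _ hP =>
    (Scheme.errorProb_le _ W hP
      fun t => prodProb_memoryScheme_le hℓ h4 hτ hm hθ hW t).trans_lt h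

end Schemes

/-! ### Sample sizes -/

section SampleSizes

variable {τ ℓ : ℕ}

lemma natCast_le_ofReal {n : ℕ} {x : ℝ} (h : (n : ℝ) ≤ x) : (n : ENNReal) ≤ ENNReal.ofReal x := by
  rw [← ENNReal.ofReal_natCast]
  exact ENNReal.ofReal_le_ofReal h

lemma mul_two_mul_exp_lt {K ε η x : ℝ} (hK : 0 < K) (hε : 0 < ε) (hη : 0 < η)
    (h : 2 * |Real.log (2 * K / ε)| / η ^ 2 < x) : K * (2 * Real.exp (-(x * η ^ 2 / 2))) < ε := by
  rw [div_lt_iff₀ (by positivity)] at h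
  have h1 : Real.log (2 * K / ε) < x * η ^ 2 / 2 := by
    have := le_abs_self (Real.log (2 * K / ε))
    linarith
  rw [Real.log_lt_iff_lt_exp (by positivity), div_lt_iff₀ hε] at h1
  rw [Real.exp_neg, ← mul_assoc, ← div_eq_mul_inv, div_lt_iff₀ (Real.exp_pos _)]
  linarith

/-- The scheme without workers that puts all objects together. -/
def trivialScheme (τ ℓ : ℕ) : Scheme τ ℓ 0 where
  order _ := Equiv.refl _
  decode _ := ⊤

lemma sampleComplexity_eq_zero_of_card_le_one {ε : ℝ} (hε : 0 < ε) (hτ : τ ≤ 1) (θd θm : ℝ) :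
    sampleComplexity τ ℓ ε θd θm = 0 := by
  have h := sampleComplexity_le (ε := ε) (θd := θd) (θm := θm) (trivialScheme τ ℓ)
    fun W _ _ P hP => by
      refine (Scheme.errorProb_le (δ := 0) _ W hP fun t => ?_).trans_lt hε
      have hker : Setoid.ker t = ⊤ := by
        ext x y
        have : t x = t y := Fin.ext (by omega)
        simp [Setoid.ker_def, this]
      simp [prodProb, trivialScheme, hker]
  simpa using h

lemma sampleComplexity_eq_zero_of_forall_not {ε θd θm : ℝ}
    (h : ∀ W : WorkerPool τ ℓ, (θd : EReal) ≤ W.distanceQuality →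
      ¬ (θm : EReal) ≤ W.memoryQuality) : sampleComplexity τ ℓ ε θd θm = 0 := by
  have h := sampleComplexity_le (ε := ε) (trivialScheme τ ℓ)
    fun W hd hm => absurd hm (h W hd)
  simpa using h

lemma le_two_of_le_distanceQuality [NeZero ℓ] (hτ : 2 ≤ τ) {θ : ℝ} {W : WorkerPool τ ℓ}
    (hW : (θ : EReal) ≤ W.distanceQuality) : θ ≤ 2 := by
  have hne : (⟨0, by omega⟩ : Fin τ) ≠ ⟨1, by omega⟩ := by simp
  exact (W.le_tvDist_of_le_distanceQuality hW hne).trans (W.tvDist_meanMarginal_le_two _ _)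

/-- Memory quality is bounded as soon as some label sequence constrains it. -/
lemma le_of_le_memoryQuality (hℓ : 2 ≤ ℓ) (h4 : 4 ≤ ℓ) (hτ : 2 ≤ τ) {θ : ℝ} {W : WorkerPool τ ℓ}
    (hW : (θ : EReal) ≤ W.memoryQuality) : θ ≤ (τ + 1) ^ ℓ := by
  let t : Fin ℓ → Fin τ :=
    fun i => if i = penultPos hℓ then ⟨1, by omega⟩ else ⟨0, by omega⟩
  let j : Fin ℓ := ⟨ℓ - 3, by omega⟩
  have hj : j < penultPos hℓ := by simp only [j, penultPos, Fin.lt_def]; omega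
  have hpl := penultPos_lt_lastPos hℓ
  have hs : lastSame t (lastPos hℓ) = some j := by
    refine lastSame_eq_some_iff.mpr ⟨hj.trans hpl, by simp [t, hj.ne, hpl.ne'],
      fun k hk hk' => ?_⟩
    have hkc : k ≠ penultPos hℓ := by
      rintro rfl
      simp [t, hpl.ne'] at hk'
    have := ((lt_lastPos_iff hℓ).mp hk).resolve_right hkc
    simp only [j, penultPos, Fin.lt_def, Fin.le_def] at this ⊢
    omega
  have h0 : (⟨0, by omega⟩ : Fin ℓ) < penultPos hℓ := by
    simp only [penultPos, Fin.lt_def]; omega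
  have h := W.lastInfo_gap hℓ hW t hs hj.ne h0 (by simp only [j, ne_eq, Fin.ext_iff]; omega)
  have hge := fun S => entropy_nonneg (W.meanLaw_nonneg t) (W.sum_meanLaw t) S
  have hle := fun S => entropy_le (W.meanLaw_nonneg t) S
  unfold lastInfo mutualInfo at h
  have h1 := hle ({penultPos hℓ} ∪ {j})
  have h2 := hge ({lastPos hℓ} ∪ ({penultPos hℓ} ∪ {j}))
  have h3 := hge ({penultPos hℓ} ∪ {⟨0, by omega⟩})
  have h4 := hle ({lastPos hℓ} ∪ ({penultPos hℓ} ∪ {⟨0, by omega⟩}))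
  linarith

/-- Universal clustering by distance needs `O(log ℓ)` responses per object. -/
lemma exists_sampleComplexity_le_log (τ : ℕ) {ε θd : ℝ} (hε : 0 < ε) (hθ : 0 < θd) (θm : ℝ) :
    ∃ C : ℝ, 0 < C ∧ ∀ ℓ : ℕ, 2 ≤ ℓ →
      (sampleComplexity τ ℓ ε θd θm : ENNReal) ≤ ENNReal.ofReal (C * Real.log ℓ) := by
  set η : ℝ := θd / (4 * (τ + 1)) with hη
  have hη0 : 0 < η := by positivity
  set a : ℝ := |Real.log (2 * (τ + 1) / ε)| with ha
  have ha0 : 0 ≤ a := abs_nonneg _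
  have hl2 : 0 < Real.log 2 := Real.log_pos (by norm_num)
  set B : ℝ := 2 / η ^ 2 * (1 + a / Real.log 2) with hB
  have hB0 : 0 < B := by positivity
  refine ⟨B + 1 / Real.log 2, by positivity, fun ℓ hℓ => ?_⟩
  have : NeZero ℓ := ⟨by omega⟩
  have hℓ' : (2 : ℝ) ≤ ℓ := by exact_mod_cast hℓ
  have hlog : Real.log 2 ≤ Real.log ℓ := Real.log_le_log (by norm_num) hℓ'
  have hlog0 : 0 < Real.log ℓ := hl2.trans_le hlog
  have hone : 1 ≤ 1 / Real.log 2 * Real.log ℓ := by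
    rw [one_div_mul_eq_div, le_div_iff₀ hl2]; linarith
  refine (sampleComplexity_le_of_distance θm hθ (n := ⌊B * Real.log ℓ⌋₊ + 1) (by omega) ?_).trans
    (natCast_le_ofReal ?_)
  · refine mul_two_mul_exp_lt (by positivity) hε hη0 ?_
    have h1 : |Real.log (2 * (ℓ * (τ + 1)) / ε)| ≤ Real.log ℓ + a := by
      have e : 2 * ((ℓ : ℝ) * (τ + 1)) / ε = ℓ * (2 * (τ + 1) / ε) := by ring
      rw [e, Real.log_mul (by positivity) (by positivity)]
      exact (abs_add_le _ _).trans_eq (by rw [abs_of_pos hlog0])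
    have h2 : a ≤ a / Real.log 2 * Real.log ℓ := by
      rw [div_mul_eq_mul_div, le_div_iff₀ hl2]
      exact mul_le_mul_of_nonneg_left hlog ha0
    calc 2 * |Real.log (2 * (ℓ * (τ + 1)) / ε)| / η ^ 2
        = 2 / η ^ 2 * |Real.log (2 * (ℓ * (τ + 1)) / ε)| := by ring
      _ ≤ 2 / η ^ 2 * (Real.log ℓ + a / Real.log 2 * Real.log ℓ) := by gcongr; linarith
      _ = B * Real.log ℓ := by rw [hB]; ring
      _ < _ := by exact_mod_cast Nat.lt_floor_add_one _
  · have := Nat.floor_le (mul_nonneg hB0.le hlog0.le)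
    push_cast
    rw [add_mul]
    linarith

/-- The sample size `⌊B / θ ^ 2⌋ + 1` is `O(θ⁻²)` for bounded `θ`, also in terms of a sum `s` in
which `θ` is the greater term. -/
lemma floor_add_one_le {B M θ s : ℝ} (hB : 0 ≤ B) (hθ : 0 < θ) (hM : θ ≤ M) (hs : 0 < s)
    (hsθ : s ≤ 2 * θ) :
    ((⌊B / θ ^ 2⌋₊ + 1 : ℕ) : ℝ) ≤ 4 * (B + M ^ 2) * s ^ (-2 : ℤ) := by
  have h1 : ((⌊B / θ ^ 2⌋₊ : ℕ) : ℝ) ≤ B / θ ^ 2 := Nat.floor_le (by positivity)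
  have h2 : 1 ≤ M ^ 2 / θ ^ 2 := by
    rw [le_div_iff₀ (by positivity), one_mul]
    exact pow_le_pow_left₀ hθ.le hM 2
  have h3 : 1 / θ ^ 2 ≤ 4 * s ^ (-2 : ℤ) := by
    rw [zpow_neg, zpow_ofNat, ← div_eq_mul_inv, div_le_div_iff₀ (by positivity) (by positivity)]
    nlinarith
  push_cast
  calc ((⌊B / θ ^ 2⌋₊ : ℕ) : ℝ) + 1 ≤ B / θ ^ 2 + M ^ 2 / θ ^ 2 := add_le_add h1 h2
    _ = (B + M ^ 2) * (1 / θ ^ 2) := by ring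
    _ ≤ (B + M ^ 2) * (4 * s ^ (-2 : ℤ)) := by gcongr
    _ = _ := by ring

lemma exists_sampleComplexity_le_of_distance [NeZero ℓ] (hτ : 2 ≤ τ) {ε : ℝ} (hε : 0 < ε) :
    ∃ C : ℝ, 0 < C ∧ ∀ θd θm : ℝ, 0 < θd + θm → θm ≤ θd →
      (sampleComplexity τ ℓ ε θd θm : ENNReal)
        ≤ ENNReal.ofReal (C * (θd + θm) ^ (-2 : ℤ)) := by
  set a : ℝ := |Real.log (2 * (ℓ * (τ + 1)) / ε)| with ha
  set B : ℝ := 2 * a * (4 * (τ + 1)) ^ 2 with hB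
  have hB0 : 0 ≤ B := by positivity
  refine ⟨4 * (B + 2 ^ 2), by positivity, fun θd θm hs hle => ?_⟩
  by_cases h2 : θd ≤ 2
  · have hθ : 0 < θd := by linarith
    refine (sampleComplexity_le_of_distance θm hθ (n := ⌊B / θd ^ 2⌋₊ + 1) (by omega) ?_).trans
      (natCast_le_ofReal (floor_add_one_le hB0 hθ h2 hs (by linarith)))
    have hℓ0 : (0 : ℝ) < ℓ := by exact_mod_cast Nat.pos_of_ne_zero (NeZero.ne ℓ)
    refine mul_two_mul_exp_lt (by positivity) hε (by positivity) ?_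
    rw [← ha]
    calc 2 * a / (θd / (4 * (τ + 1))) ^ 2 = B / θd ^ 2 := by rw [hB]; field_simp
      _ < _ := by exact_mod_cast Nat.lt_floor_add_one _
  · rw [sampleComplexity_eq_zero_of_forall_not fun W hd _ =>
      h2 (le_two_of_le_distanceQuality hτ hd)]
    simp

lemma exists_sampleComplexity_le_of_memory (h4 : 4 ≤ ℓ) (hτ : 2 ≤ τ) (hτℓ : τ < ℓ) {ε : ℝ}
    (hε : 0 < ε) :
    ∃ C : ℝ, 0 < C ∧ ∀ θd θm : ℝ, 0 < θd + θm → θd ≤ θm →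
      (sampleComplexity τ ℓ ε θd θm : ENNReal)
        ≤ ENNReal.ofReal (C * (θd + θm) ^ (-2 : ℤ)) := by
  have hℓ : 2 ≤ ℓ := by omega
  set M : ℝ := (τ + 1) ^ ℓ with hM
  have hM0 : 0 < M := by positivity
  set F : ℝ := (Fintype.card (Equiv.Perm (Fin ℓ)) : ℝ) with hF
  have hF0 : 0 < F := by rw [hF]; exact_mod_cast Fintype.card_pos
  set K : ℝ := (Fintype.card (Equiv.Perm (Fin ℓ) × Finset (Fin ℓ)) : ℝ) with hK
  have hK0 : 0 < K := by rw [hK]; exact_mod_cast Fintype.card_pos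
  set B : ℝ := K * M * (576 + 12 * M) / ε with hB
  have hB0 : 0 ≤ B := by positivity
  refine ⟨F * (4 * (B + M ^ 2)), by positivity, fun θd θm hs hle => ?_⟩
  by_cases h2 : θm ≤ M
  · have hθ : 0 < θm := by linarith
    refine (sampleComplexity_le_of_memory θd hℓ h4 hτℓ hθ (m := ⌊B / θm ^ 2⌋₊ + 1)
      (by omega) ?_).trans (natCast_le_ofReal ?_)
    · have hm : B / θm ^ 2 < ((⌊B / θm ^ 2⌋₊ + 1 : ℕ) : ℝ) := by
        exact_mod_cast Nat.lt_floor_add_one _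
      have hm0 : (0 : ℝ) < ((⌊B / θm ^ 2⌋₊ + 1 : ℕ) : ℝ) := by positivity
      rw [← hK, ← hM, mul_div_assoc', div_lt_iff₀ hm0]
      have e1 : 16 / (θm / 6) ^ 2 + 2 / (θm / 6) ≤ (576 + 12 * M) / θm ^ 2 := by
        have : 16 / (θm / 6) ^ 2 + 2 / (θm / 6) = (576 + 12 * θm) / θm ^ 2 := by
          field_simp; ring
        rw [this]
        gcongr
      calc K * (M * (16 / (θm / 6) ^ 2 + 2 / (θm / 6)))
          ≤ K * (M * ((576 + 12 * M) / θm ^ 2)) := by gcongr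
        _ = ε * (B / θm ^ 2) := by rw [hB]; field_simp
        _ < _ := by gcongr
    · rw [Fintype.card_prod, Fintype.card_fin, Nat.cast_mul, ← hF, mul_assoc]
      exact mul_le_mul_of_nonneg_left (floor_add_one_le hB0 hθ h2 hs (by linarith)) hF0.le
  · rw [sampleComplexity_eq_zero_of_forall_not fun W _ hm =>
      h2 (le_of_le_memoryQuality hℓ h4 hτ hm)]
    simp

end SampleSizes

end CrowdClustering

theorem mainTheorem10 (τ : ℕ) (ε : ℝ) (hε : 0 < ε) :
    (∀ θd θm : ℝ, 0 < θd → 0 < θm →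
      ∃ C : ℝ, 0 < C ∧ ∀ ℓ : ℕ, 2 ≤ ℓ →
        (CrowdClustering.sampleComplexity τ ℓ ε θd θm : ENNReal)
          ≤ ENNReal.ofReal (C * Real.log ℓ)) ∧
    (∀ ℓ : ℕ, τ ^ 2 < ℓ →
      ∃ C : ℝ, 0 < C ∧ ∀ θd θm : ℝ, 0 < θd + θm →
        (CrowdClustering.sampleComplexity τ ℓ ε θd θm : ENNReal)
          ≤ ENNReal.ofReal (C * (θd + θm) ^ (-2 : ℤ))) := by
  refine ⟨fun θd θm hd _ => CrowdClustering.exists_sampleComplexity_le_log τ hε hd θm,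
    fun ℓ hℓ => ?_⟩
  rcases Nat.lt_or_ge 1 τ with hτ | hτ
  · have hℓ4 : 4 ≤ ℓ := by nlinarith
    have hτℓ : τ < ℓ := by nlinarith
    have : NeZero ℓ := ⟨by omega⟩
    obtain ⟨C₁, hC₁, h₁⟩ := CrowdClustering.exists_sampleComplexity_le_of_distance (ℓ := ℓ) hτ hε
    obtain ⟨C₂, hC₂, h₂⟩ := CrowdClustering.exists_sampleComplexity_le_of_memory hℓ4 hτ hτℓ hε
    refine ⟨max C₁ C₂, lt_max_of_lt_left hC₁, fun θd θm hs => ?_⟩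
    have hz : 0 ≤ (θd + θm) ^ (-2 : ℤ) := zpow_nonneg hs.le _
    rcases le_total θm θd with hle | hle
    · exact (h₁ θd θm hs hle).trans
        (ENNReal.ofReal_le_ofReal (mul_le_mul_of_nonneg_right (le_max_left _ _) hz))
    · exact (h₂ θd θm hs hle).trans
        (ENNReal.ofReal_le_ofReal (mul_le_mul_of_nonneg_right (le_max_right _ _) hz))
  · refine ⟨1, one_pos, fun θd θm _ => ?_⟩
    rw [CrowdClustering.sampleComplexity_eq_zero_of_card_le_one hε hτ]
    simp
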